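/- **Notation.** Let $\lambda=(\lambda_1\ge\dots\ge\lambda_r>0)$ be a partition, identified with its Ferrers diagram; $(i,j)$ is the cell in row $i$ and column $j$ (numbered from $1$). For a cell $\rho=(i,j)$ let $c_\rho=j-i$ be its content, $a_\rho$ the number of cells to the right of $\rho$ in its row, and $l_\rho$ the number of cells below $\rho$ in its column. All fillings are by integers. For an integer $b\ge r$: a *tableau* is a filling of $\lambda$ with entries in $[1,b]$, weakly increasing along rows and strictly increasing down columns (a semistandard tableau); a *content tabloid* is a filling $C$ with $1-c_\rho\le C_\rho\le b$ for all $\rho$; a *hook tabloid* is a filling $H$ with $-a_\rho\le H_\rho\le l_\rho$ for all $\rho$. Order the cells column by column from left to right, and each column from top to bottom. **Algorithm HC.** Input: a content tabloid $C$. Start with $(T,H)=(C,\mathbf 0)$, where $\mathbf 0$ is the filling by zeros. Let $\omega$ run through all cells, from the last to the first in the above order, and for each $\omega=(i,j)$ do the following. (1) Let $s$ be the entry of $T$ in $\omega$. Repeat: let $x$ and $y$ be the right and bottom neighbours of $s$ ($=\infty$ if missing). If $s\le x$ and $s<y$, stop. Otherwise, if $x+1<y$, write $x+1$ in the cell of $s$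 and $s$ in the cell of $x$; if $x\ge y-1$, write $y-1$ in the cell of $s$ and $s$ in the cell of $y$. (2) If $s$ stops in $(i',j')$, replace simultaneously $H_{(k,j)}$ by $H_{(k+1,j)}+1$ for $k=i,\dots,i'-1$, and $H_{(i',j)}$ by $j-j'$. The output is the final pair $(T,H)$. **Algorithm PP.** Let $a,b,c$ be non-negative integers. Input: a filling $F$ of the $a\times c$ rectangle $(c^a)$ (with $a$ rows of length $c$) whose entry in cell $(i,j)$ lies in $[i-a,\,b+j-1]$. Let $\omega$ run through the cells from the last to the first, and for each $\omega$ let $s$ be the entry in $\omega$. Repeat: let $x$ and $y$ be the right and bottom neighbours of $s$ ($=-\infty$ if missing). If $s\ge x$ and $s\ge y$, stop. Otherwise, if $x-1\ge y$, write $x-1$ in the cell of $s$ and $s$ in the cell of $x$ (this $s$ is the new special entry); if $x\le y$, write $y$ in the cell of $s$ and $s+1$ in the cell of $y$ (this $s+1$ is the new special entry $s$). The output is the final filling $P$. A *plane partition in an $a\times b\times c$ box* is a filling of $(c^a)$ with entries in $[0,b]$, weakly decreasing along rows and columns. **Theorem.** (a) Let $\lambda$ be a partition with $r$ rows and $b\ge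 r$ an integer. Algorithm HC is a bijection from the content tabloids of shape $\lambda$ onto the pairs $(T,H)$ of a tableau $T$ of shape $\lambda$ with entries in $[1,b]$ and a hook tabloid $H$ of shape $\lambda$. If the entries $C_\rho$ are chosen independently, each $C_\rho$ uniformly from $\{1-c_\rho,\dots,b\}$, and $(T,H)$ is the output of Algorithm HC, then $H$ is uniformly distributed on the hook tabloids of shape $\lambda$, and $T$ is uniformly distributed on the semistandard tableaux of shape $\lambda$ with entries in $[1,b]$. (b) Let $a,b,c\ge 0$ be integers. The map that replaces each entry $e$ in row $i$ by $b-e+i$ is a bijection from the plane partitions in an $a\times b\times c$ box onto the tableaux of shape $(c^a)$ with entries in $[1,a+b]$, and it is a bijection from the inputs of Algorithm PP onto the content tabloids of shape $(c^a)$ with upper bound $a+b$. It carries the output of Algorithm PP on $F$ to the tableau $T$ that Algorithm HC produces from the image of $F$. If the entries of $F$ are chosen independently, the one in $(i,j)$ uniformly from $\{i-a,\dots,b+j-1\}$, then the output of Algorithm PP is uniformly distributed on the plane partitions in an $a\times b\times c$ box. (c) On every input, the number of moves performed by Algorithm PP is $O\big(\sum_{i=a}^{a+c-1}\binom i2\big)$,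 which is $O\big(c(3a^2+3ac+c^2)\big)$, with constants independent of $a,b,c$ and of the input. -/

import Mathlib

open Set MeasureTheory ProbabilityTheory

namespace HookContent

/-- The cells of the Ferrers diagram `μ`. Rows and columns are numbered from `0`, so `(i, j)` is the
cell in row `i + 1` and column `j + 1` of the usual numbering from `1`. -/
abbrev Cell (μ : YoungDiagram) : Type := {p : ℕ × ℕ // p ∈ μ}

/-- A filling of the cells of `μ` with integers. -/
abbrev Filling (μ : YoungDiagram) : Type := Cell μ → ℤ

variable {μ : YoungDiagram}

/-- The row index of a cell (from `0`). -/
abbrev Cell.row (p : Cell μ) : ℕ := p.1.1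

/-- The column index of a cell (from `0`). -/
abbrev Cell.col (p : Cell μ) : ℕ := p.1.2

/-- The content of a cell, column minus row. -/
def content (p : Cell μ) : ℤ := (p.col : ℤ) - (p.row : ℤ)

/-- The arm length: the number of cells of `μ` in the same row and to the right. -/
def arm (p : Cell μ) : ℤ := (μ.rowLen p.row : ℤ) - (p.col : ℤ) - 1

/-- The leg length: the number of cells of `μ` in the same column and below. -/
def leg (p : Cell μ) : ℤ := (μ.colLen p.col : ℤ) - (p.row : ℤ) - 1

/-- Semistandard tableaux of shape `μ` with entries between `1` and `b`. -/
def tableaux (μ : YoungDiagram) (b : ℕ) : Set (Filling μ) :=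
  {T | (∀ p q : Cell μ, p.row = q.row → p.col < q.col → T p ≤ T q) ∧
       (∀ p q : Cell μ, p.col = q.col → p.row < q.row → T p < T q) ∧
       ∀ p, 1 ≤ T p ∧ T p ≤ (b : ℤ)}

/-- Content tabloids of shape `μ` (with upper bound `b`). -/
def contentTabloids (μ : YoungDiagram) (b : ℕ) : Set (Filling μ) :=
  {C | ∀ p, 1 - content p ≤ C p ∧ C p ≤ (b : ℤ)}

/-- Hook tabloids of shape `μ`. -/
def hookTabloids (μ : YoungDiagram) : Set (Filling μ) :=
  {H | ∀ p, -arm p ≤ H p ∧ H p ≤ leg p}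

/-- The fixed total order of the cells, as a list: column by column from left to right, each
column from top to bottom. -/
def cellList (μ : YoungDiagram) : List (Cell μ) :=
  (List.finRange (μ.rowLen 0)).flatMap fun j : Fin (μ.rowLen 0) =>
    (List.finRange (μ.colLen j)).map fun i : Fin (μ.colLen j) =>
      (⟨((i : ℕ), (j : ℕ)), YoungDiagram.mem_iff_lt_colLen.2 i.isLt⟩ : Cell μ)

/-- The right neighbour of a cell, if there is one. -/
def rightOf (p : Cell μ) : Option (Cell μ) :=
  if h : (p.row, p.col + 1) ∈ μ then some ⟨(p.row, p.col + 1), h⟩ else none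

/-- The bottom neighbour of a cell, if there is one. -/
def below (p : Cell μ) : Option (Cell μ) :=
  if h : (p.row + 1, p.col) ∈ μ then some ⟨(p.row + 1, p.col), h⟩ else none

/-- An upper bound for the number of moves which an entry can still make; it only serves to show
that the sliding procedures below terminate. -/
def room (p : Cell μ) : ℕ := (μ.colLen 0 - p.row) + (μ.rowLen 0 - p.col)

theorem room_rightOf {p q : Cell μ} (h : rightOf p = some q) : room q < room p := by
  unfold rightOf at h
  split at h
  · rename_i hm
    obtain rfl := Option.some.inj h
    have h0 : (0, p.col + 1) ∈ μ := μ.up_left_mem (Nat.zero_le _) le_rfl hm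
    have hlt := YoungDiagram.mem_iff_lt_rowLen.1 h0
    simp only [room, Cell.row, Cell.col] at hlt ⊢
    omega
  · cases h

theorem room_below {p q : Cell μ} (h : below p = some q) : room q < room p := by
  unfold below at h
  split at h
  · rename_i hm
    obtain rfl := Option.some.inj h
    have h0 : (p.row + 1, 0) ∈ μ := μ.up_left_mem le_rfl (Nat.zero_le _) hm
    have hlt := YoungDiagram.mem_iff_lt_colLen.1 h0
    simp only [room, Cell.row, Cell.col] at hlt ⊢
    omega
  · cases h

/-- The entry in an optional cell, a missing cell having entry `∞`. -/
def topEntry (T : Filling μ) : Option (Cell μ) → WithTop ℤ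
  | some q => ((T q : ℤ) : WithTop ℤ)
  | none => ⊤

/-- The entry in an optional cell, a missing cell having entry `-∞`. -/
def botEntry (T : Filling μ) : Option (Cell μ) → WithBot ℤ
  | some q => ((T q : ℤ) : WithBot ℤ)
  | none => ⊥

/-- Modified jeu de taquin: the special entry `s` in cell `p` of `T` is moved to the right/bottom.
With right neighbour `x` and bottom neighbour `y` (equal to `∞` if missing):
stop if `s ≤ x` and `s < y`; otherwise, if `x + 1 < y`, put `x + 1` in `p` and move `s` to the
right, and if `x ≥ y - 1`, put `y - 1` in `p` and move `s` down. Repeat.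
The result is the final array together with the cell where the special entry stops.
(The branches `none` are never reached.) -/
noncomputable def slideHC (T : Filling μ) (p : Cell μ) : Filling μ × Cell μ :=
  if (T p : WithTop ℤ) ≤ topEntry T (rightOf p) ∧ (T p : WithTop ℤ) < topEntry T (below p) then
    (T, p)
  else if topEntry T (rightOf p) + 1 < topEntry T (below p) then
    match h : rightOf p with
    | some q => slideHC (Function.update (Function.update T p (T q + 1)) q (T p)) q
    | none => (T, p)
  else
    match h : below p with
    | some q => slideHC (Function.update (Function.update T p (T q - 1)) q (T p)) q
    | none => (T, p)
termination_by room p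
decreasing_by
  · exact room_rightOf h
  · exact room_below h

/-- The change of the hook tabloid when the special entry was moved from `p = (i, j)` to
`p' = (i', j')`: for `k = i, …, i' - 1` the entry in `(k, j)` becomes the old entry in `(k + 1, j)`
plus `1`, the entry in `(i', j)` becomes `j - j'`, all other entries are left unchanged.
(The branch `none` is not reached if `p'` is weakly to the right of and below `p`.) -/
def updateHook (H : Filling μ) (p p' : Cell μ) : Filling μ := fun k =>
  if k.col = p.col ∧ p.row ≤ k.row ∧ k.row < p'.row then
    match below k with
    | some d => H d + 1
    | none => H k
  else if k.col = p.col ∧ k.row = p'.row then (p.col : ℤ) - (p'.col : ℤ)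
  else H k

/-- One loop of Algorithm HC, with distinguished cell `p`. -/
noncomputable def loopHC (S : Filling μ × Filling μ) (p : Cell μ) : Filling μ × Filling μ :=
  ((slideHC S.1 p).1, updateHook S.2 p (slideHC S.1 p).2)

/-- Algorithm HC: start with `(C, 0)` and perform the loop with the distinguished cell running
through all cells, from the last one to the first one in the fixed total order. -/
noncomputable def algorithmHC (C : Filling μ) : Filling μ × Filling μ :=
  (cellList μ).reverse.foldl loopHC (C, 0)

/-- The rectangular Ferrers diagram `(c ^ a)` with `a` rows of length `c`. -/
def rect (a c : ℕ) : YoungDiagram where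
  cells := Finset.range a ×ˢ Finset.range c
  isLowerSet := by
    rintro ⟨i, j⟩ ⟨i', j'⟩ ⟨h1, h2⟩ h
    simp only [Finset.coe_product, Finset.coe_range, Set.mem_prod, Set.mem_Iio] at h h1 h2 ⊢
    omega

/-- Plane partitions of shape `μ` with entries between `0` and `b`. -/
def planePartitions (μ : YoungDiagram) (b : ℕ) : Set (Filling μ) :=
  {F | (∀ p q : Cell μ, p.row = q.row → p.col < q.col → F q ≤ F p) ∧
       (∀ p q : Cell μ, p.col = q.col → p.row < q.row → F q ≤ F p) ∧
       ∀ p, 0 ≤ F p ∧ F p ≤ (b : ℤ)}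

/-- The smallest entry allowed in a cell for an input of Algorithm PP: `i - a` if the cell is in
row `i` (numbered from `1`). -/
def lowerPP (a : ℕ) (p : Cell μ) : ℤ := ((p.row : ℤ) + 1) - (a : ℤ)

/-- The largest entry allowed in a cell for an input of Algorithm PP: `b + j - 1` if the cell is in
column `j` (numbered from `1`). -/
def upperPP (b : ℕ) (p : Cell μ) : ℤ := (b : ℤ) + ((p.col : ℤ) + 1) - 1

/-- The inputs of Algorithm PP. -/
def inputsPP (a b c : ℕ) : Set (Filling (rect a c)) :=
  {F | ∀ p, lowerPP a p ≤ F p ∧ F p ≤ upperPP b p}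

/-- Replace each entry `e` in row `i` (numbered from `1`) by `b - e + i`. -/
def complementFilling (b : ℕ) (F : Filling μ) : Filling μ :=
  fun p => (b : ℤ) - F p + ((p.row : ℤ) + 1)

/-- The moves of Algorithm PP, for the special entry `s` in cell `p` of `F`.
With right neighbour `x` and bottom neighbour `y` (equal to `-∞` if missing):
stop if `s ≥ x` and `s ≥ y`; otherwise, if `x - 1 ≥ y`, put `x - 1` in `p` and move `s` to the
right, and if `x ≤ y`, put `y` in `p` and `s + 1` in the cell below, which is the new special
entry. Repeat. The result is the final array together with the number of moves.
(The branches `none` are never reached.) -/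
noncomputable def slidePP (F : Filling μ) (p : Cell μ) : Filling μ × ℕ :=
  if botEntry F (rightOf p) ≤ (F p : WithBot ℤ) ∧ botEntry F (below p) ≤ (F p : WithBot ℤ) then
    (F, 0)
  else if botEntry F (below p) + 1 ≤ botEntry F (rightOf p) then
    match h : rightOf p with
    | some q =>
      let R := slidePP (Function.update (Function.update F p (F q - 1)) q (F p)) q
      (R.1, R.2 + 1)
    | none => (F, 0)
  else
    match h : below p with
    | some q =>
      let R := slidePP (Function.update (Function.update F p (F q)) q (F p + 1)) q
      (R.1, R.2 + 1)
    | none => (F, 0)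
termination_by room p
decreasing_by
  · exact room_rightOf h
  · exact room_below h

/-- One loop of Algorithm PP, with distinguished cell `p`; the second component counts moves. -/
noncomputable def loopPP (S : Filling μ × ℕ) (p : Cell μ) : Filling μ × ℕ :=
  ((slidePP S.1 p).1, S.2 + (slidePP S.1 p).2)

/-- Algorithm PP together with its total number of moves. -/
noncomputable def runPP {a c : ℕ} (F : Filling (rect a c)) : Filling (rect a c) × ℕ :=
  (cellList (rect a c)).reverse.foldl loopPP (F, 0)

/-- The output of Algorithm PP. -/
noncomputable def algorithmPP {a c : ℕ} (F : Filling (rect a c)) : Filling (rect a c) := (runPP F).1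

/-- The number of moves performed by Algorithm PP. -/
noncomputable def movesPP {a c : ℕ} (F : Filling (rect a c)) : ℕ := (runPP F).2

/-- The entries `X p` of a random filling are chosen independently, the entry in `p` uniformly from
the integers between `lo p` and `hi p`. -/
structure IsIndepUniform {Ω : Type*} [MeasurableSpace Ω] (P : Measure Ω)
    (X : Cell μ → Ω → ℤ) (lo hi : Cell μ → ℤ) : Prop where
  measurable : ∀ p, Measurable (X p)
  indep : iIndepFun X P
  uniform : ∀ p, P.map (X p) = uniformOn (Set.Icc (lo p) (hi p))

end HookContent

open HookContent

/-! Add to every entry of a filling its content. In this grid the special entry `s` counts as `s + c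
- r` when it sits in cell `(r, c)`, and all other entries slide without changing, so a loop of
Algorithm HC is ordinary jeu de taquin for arrays with strictly increasing rows and weakly
increasing columns. Content tabloids become the grids with `1 ≤ G r c ≤ b + c - r`.

A loop can be undone once the cell `(k, x)` in which the special entry stopped is known: the sliding
path is retraced by going repeatedly to the larger of the left and upper neighbours, to the left one
if they are equal (`BackPath`, `FwdPath.backPath_shift`). The hook tabloid has to remember that
cell. In the current column `j`, each row `r ≥ i` with entry `h r ≤ 0` names the candidate `(r, j -
h r)`, and the true cell is among the candidates. Reverse paths cannot cross, so they can be
compared, and the true one is the outermost: candidates in higher rows lie strictly to the left of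
its path, and reverse paths from lower rows meet row `k` weakly to the left of `x` (`Champion`). A
forward loop produces a champion (`FwdPath.champion`), and champions exist and are unique
(`exists_champion`, `Champion.unique`). Hence retracing the champion's path inverts the loop.

The invariant `Stage` contains, besides order and bounds, the condition `Good`: the reverse paths
from all candidates reach column `j` no higher than row `i`. It holds automatically for `i = 0`, so
it carries no information from one column to the next. Each loop is a bijection between consecutive
stages (`bijOn_loopHC`); the first stage consists of the content tabloids with zero hook filling,
the last one of the pairs of a tableau and a hook tabloid.

Algorithm PP is the tableau part of Algorithm HC conjugated by the complement
(`complementFilling_algorithmPP`), and a special entry makes at most as many moves as its distance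
from the opposite corner of the rectangle. For the distributions, a bijection carries the uniform
measure on a finite set to the uniform measure, and the uniform measure on a product with nonempty
factors has uniform marginals. -/

namespace HookContent

/-! ### Grids, sliding paths and reverse paths. -/

/-- The cell `(r, c)` of the diagram with row lengths `R` lies to the right of column `j`, or in
column `j` in row `i` or below. -/
def Processed (R : ℕ → ℕ) (i j r c : ℕ) : Prop := c < R r ∧ (j < c ∨ (c = j ∧ i ≤ r))

/-- The grid `G` has strictly increasing rows and weakly increasing columns on the processed
cells. -/
structure SortedFrom (R : ℕ → ℕ) (i j : ℕ) (G : ℕ → ℕ → ℤ) : Prop where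
  row : ∀ r c, Processed R i j r c → c + 1 < R r → G r c < G r (c + 1)
  col : ∀ r c, Processed R i j r c → c < R (r + 1) → G r c ≤ G (r + 1) c

/-- A lattice path from `(i, j)` to `(k, x)`, which occupies the columns from `f r` to `f (r + 1)`
in row `r`. -/
structure IsPath (i j k x : ℕ) (f : ℕ → ℕ) : Prop where
  le : i ≤ k
  start : f i = j
  finish : f (k + 1) = x
  mono : ∀ r, i ≤ r → r ≤ k → f r ≤ f (r + 1)

/-- The path `f` is the reverse sliding path in `G` which starts in `(k, x)` and ends in
`(i, j)`. -/
structure BackPath (G : ℕ → ℕ → ℤ) (i j k x : ℕ) (f : ℕ → ℕ) : Prop extends IsPath i j k x f where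
  left : ∀ r c, i ≤ r + 1 → r + 1 ≤ k → f (r + 1) ≤ c → c < f (r + 1 + 1) →
    G r (c + 1) ≤ G (r + 1) c
  up : ∀ r c, i ≤ r → r + 1 ≤ k → f (r + 1) = c + 1 → j ≤ c → G (r + 1) c < G r (c + 1)

/-- The path `f` is the sliding path in `G` of the special entry `s` from `(i, j)` to `(k, x)`. -/
structure FwdPath (R : ℕ → ℕ) (G : ℕ → ℕ → ℤ) (s : ℤ) (i j k x : ℕ) (f : ℕ → ℕ) : Prop
    extends IsPath i j k x f where
  mem : x < R k
  right : ∀ r c, i ≤ r → r ≤ k → f r ≤ c → c < f (r + 1) → G r (c + 1) ≤ s + c - r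
  right' : ∀ r c, i ≤ r → r ≤ k → f r ≤ c → c < f (r + 1) → c < R (r + 1) →
    G r (c + 1) ≤ G (r + 1) c
  down : ∀ r c, i ≤ r → r < k → f (r + 1) = c → G (r + 1) c < s + c - r
  down' : ∀ r c, i ≤ r → r < k → f (r + 1) = c → c + 1 < R r → G (r + 1) c < G r (c + 1)
  stop_right : x + 1 < R k → s + x - k < G k (x + 1)
  stop_down : x < R (k + 1) → s + x - k ≤ G (k + 1) x

/-- The cell `(r, c)` lies on the path `f` between the rows `i` and `k`. -/
def OnPath (i k : ℕ) (f : ℕ → ℕ) (r c : ℕ) : Prop := i ≤ r ∧ r ≤ k ∧ f r ≤ c ∧ c ≤ f (r + 1)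

open Classical in
/-- The grid after `s` has been moved along the path `f`. -/
noncomputable def shift (G : ℕ → ℕ → ℤ) (s : ℤ) (i k : ℕ) (f : ℕ → ℕ) (r c : ℕ) : ℤ :=
  if OnPath i k f r c then
    if c < f (r + 1) then G r (c + 1) else if r < k then G (r + 1) c else s + c - r
  else G r c

open Classical in
/-- The grid after `s` has been moved back along the path `f`. -/
noncomputable def unshift (G : ℕ → ℕ → ℤ) (s : ℤ) (i k : ℕ) (f : ℕ → ℕ) (r c : ℕ) : ℤ :=
  if OnPath i k f r c then
    if f r < c then G r (c - 1) else if i < r then G (r - 1) c else s + c - r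
  else G r c

section Paths

variable {R : ℕ → ℕ} {G G' : ℕ → ℕ → ℤ} {s : ℤ} {b i j k k' m x x' : ℕ} {f g u h h' : ℕ → ℕ}

theorem IsPath.le_of_le (hf : IsPath i j k x f) {r r' : ℕ} (h₁ : i ≤ r) (h : r ≤ r')
    (h₂ : r' ≤ k + 1) : f r ≤ f r' := by
  induction r', h using Nat.le_induction with
  | base => exact le_rfl
  | succ n hn ih => exact (ih (by omega)).trans (hf.mono n (by omega) (by omega))

theorem IsPath.start_le (hf : IsPath i j k x f) {r : ℕ} (h₁ : i ≤ r) (h₂ : r ≤ k + 1) :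
    j ≤ f r := hf.start ▸ hf.le_of_le le_rfl h₁ h₂

theorem IsPath.le_stop (hf : IsPath i j k x f) {r : ℕ} (h₁ : i ≤ r) (h₂ : r ≤ k + 1) :
    f r ≤ x := hf.finish ▸ hf.le_of_le h₁ h₂ le_rfl

/-- Otherwise `g` takes a left step out of column `f r` of row `r`, in the very cell where `f` turns
upwards. The comparison of the left with the upper neighbour of this cell would then have two
outcomes. -/
theorem BackPath.not_cross (hf : BackPath G i j k x f) (hg : BackPath G i j k' x' g) {r : ℕ}
    (hr : i < r) (hk : r ≤ k) (hk' : r ≤ k') (h : f (r + 1) ≤ g (r + 1)) (hc : g r < f r) :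
    False := by
  obtain ⟨n, rfl⟩ : ∃ n, r = n + 1 := ⟨r - 1, by omega⟩
  have h0 := hg.start_le (r := n + 1) (by omega) (by omega)
  have h1 := hf.up n (f (n + 1) - 1) (by omega) (by omega) (by omega) (by omega)
  have h2 := hg.left n (f (n + 1) - 1) (by omega) (by omega) (by omega)
    (by have := hf.mono (n + 1) (by omega) (by omega); omega)
  omega

/-- A reverse path stays weakly to the left of another one. -/
theorem BackPath.le_of_le (hf : BackPath G i j k x f) (hg : BackPath G i j k' x' g) {r r' : ℕ}
    (hr : i ≤ r') (hrr : r' ≤ r) (hk : r ≤ k + 1) (hk' : r ≤ k' + 1) (h : f r ≤ g r) :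
    f r' ≤ g r' := by
  induction r, hrr using Nat.le_induction with
  | base => exact h
  | succ n hn ih =>
    refine ih (by omega) (by omega) ?_
    by_contra! hc
    rcases hn.eq_or_lt with rfl | hlt
    · rcases hr.eq_or_lt with rfl | hlt'
      · rw [hf.start, hg.start] at hc
        omega
      · exact hf.not_cross hg hlt' (by omega) (by omega) h hc
    · exact hf.not_cross hg (by omega) (by omega) (by omega) h hc

theorem BackPath.unique (hf : BackPath G i j k x f) (hg : BackPath G i j k x g) {r : ℕ}
    (h₁ : i ≤ r) (h₂ : r ≤ k + 1) : f r = g r :=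
  le_antisymm (hf.le_of_le hg h₁ h₂ le_rfl le_rfl (by rw [hf.finish, hg.finish]))
    (hg.le_of_le hf h₁ h₂ le_rfl le_rfl (by rw [hf.finish, hg.finish]))

/-- Finds the column in which a reverse path leaves a row: `Q c` permits the step from `c + 1` to
`c`, and the walk from `y` halts at the first refusal or in column `j`. -/
theorem exists_exit (Q : ℕ → Prop) {j y : ℕ} (h : j ≤ y) :
    ∃ e, j ≤ e ∧ e ≤ y ∧ (∀ c, e ≤ c → c < y → Q c) ∧ ∀ c, e = c + 1 → j ≤ c → ¬ Q c := by
  induction y, h using Nat.le_induction with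
  | base => exact ⟨j, le_rfl, le_rfl, by omega, by omega⟩
  | succ n hn ih =>
    obtain ⟨e, h1, h2, h3, h4⟩ := ih
    by_cases hq : Q n
    · refine ⟨e, h1, by omega, fun c hc hc' => ?_, h4⟩
      rcases Nat.lt_succ_iff_lt_or_eq.1 hc' with hlt | rfl
      · exact h3 c hc hlt
      · exact hq
    · refine ⟨n + 1, by omega, le_rfl, by omega, ?_⟩
      rintro c hc -
      obtain rfl : n = c := by omega
      exact hq

/-- A function `u` which satisfies the inequalities for the left steps of a reverse path bounds the
reverse paths which start weakly to the left of it. -/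
theorem exists_backPath (hu : u i = j) (hju : ∀ r, i ≤ r → r ≤ k + 1 → j ≤ u r)
    (hl : ∀ r c, i ≤ r + 1 → r + 1 ≤ k → u (r + 1) ≤ c → c < u (r + 1 + 1) →
      G r (c + 1) ≤ G (r + 1) c)
    {r y : ℕ} (hi : i ≤ r) (hk : r ≤ k) (hjy : j ≤ y) (hy : y ≤ u (r + 1)) :
    ∃ g, BackPath G i j r y g ∧ ∀ r', i ≤ r' → r' ≤ r + 1 → g r' ≤ u r' := by
  induction r, hi using Nat.le_induction generalizing y with
  | base =>
    refine ⟨fun r => if r = i then j else y, ⟨⟨le_rfl, by simp, by simp, ?_⟩, ?_, ?_⟩, ?_⟩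
    · intro r h1 h2
      obtain rfl : i = r := by omega
      simpa using hjy
    · intro r c h1 h2 h3 h4
      obtain rfl : i = r + 1 := by omega
      simp only [if_true, if_false, show r + 1 + 1 ≠ r + 1 by omega] at h3 h4
      exact hl r c h1 (by omega) (by omega) (by omega)
    · omega
    · intro r' h1 h2
      by_cases h : r' = i
      · simp [h, hu]
      · obtain rfl : r' = i + 1 := by omega
        simpa using hy
  | succ n hn ih =>
    obtain ⟨e, h1, h2, h3, h4⟩ := exists_exit (fun c => G n (c + 1) ≤ G (n + 1) c) hjy
    -- To the right of `u (n + 1)` every left step is permitted by `hl`, so the walk cannot turn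
    -- upwards before it reaches `u`.
    have he : e ≤ u (n + 1) := by
      by_contra! hlt
      have := hju (n + 1) (by omega) (by omega)
      exact h4 (e - 1) (by omega) (by omega)
        (hl n (e - 1) (by omega) (by omega) (by omega) (by omega))
    obtain ⟨g, hg, hgu⟩ := ih (by omega) h1 he
    refine ⟨fun r => if r ≤ n + 1 then g r else y, ⟨⟨by omega, ?_, by simp, ?_⟩, ?_, ?_⟩, ?_⟩
    · simp [show i ≤ n + 1 by omega, hg.start]
    · intro r hr1 hr2
      by_cases hr : r ≤ n
      · simpa [hr, show r ≤ n + 1 by omega] using hg.mono r hr1 hr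
      · obtain rfl : r = n + 1 := by omega
        simpa [hg.finish] using h2
    · intro r c hr1 hr2 hr3 hr4
      by_cases hr : r + 1 ≤ n
      · simp only [show r + 1 ≤ n + 1 by omega, show r + 1 + 1 ≤ n + 1 by omega, if_true] at hr3 hr4
        exact hg.left r c hr1 hr hr3 hr4
      · obtain rfl : r = n := by omega
        simp only [le_refl, if_true, show ¬ r + 1 + 1 ≤ r + 1 by omega, if_false, hg.finish]
          at hr3 hr4
        exact h3 c hr3 hr4
    · intro r c hr1 hr2 hr3 hr4
      simp only [hr2, if_true] at hr3
      by_cases hr : r + 1 ≤ n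
      · exact hg.up r c hr1 hr hr3 hr4
      · obtain rfl : r = n := by omega
        rw [hg.finish] at hr3
        exact not_le.1 (h4 c hr3 hr4)
    · intro r' hr1 hr2
      by_cases hr : r' ≤ n + 1
      · simpa [hr] using hgu r' hr1 hr
      · obtain rfl : r' = n + 1 + 1 := by omega
        simpa using hy

end Paths

end HookContent

/-! ### Bounds, hook columns, champions, and shifts along a path. -/

namespace HookContent

/-- Bounds for the grid when the columns to the right of column `j` and a part of column `j` are
processed. -/
structure Bounded (R : ℕ → ℕ) (b j : ℕ) (G : ℕ → ℕ → ℤ) : Prop where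
  one_le : ∀ r c, c < R r → c ≤ j → 1 ≤ G r c
  lower : ∀ r c, c < R r → j ≤ c → (c : ℤ) - j ≤ G r c
  upper : ∀ r c, c < R r → G r c ≤ b + c - r

/-- The hook bounds for column `j`, of length `m`, from row `i` on. -/
def HookRange (R : ℕ → ℕ) (m i j : ℕ) (h : ℕ → ℤ) : Prop :=
  ∀ r, i ≤ r → j < R r → -((R r : ℤ) - j - 1) ≤ h r ∧ h r ≤ (m : ℤ) - r - 1

/-- The reverse paths from all candidate cells `(r, j - h r)` end in column `j`, in row `i` or
below. -/
def Good (R : ℕ → ℕ) (G : ℕ → ℕ → ℤ) (i j : ℕ) (h : ℕ → ℤ) : Prop :=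
  ∀ r y, i ≤ r → j < R r → j ≤ y → h r = (j : ℤ) - y → ∃ g, BackPath G i j r y g

/-- The reverse path `f` from the candidate cell `(k, x)` is the largest one. -/
structure Champion (R : ℕ → ℕ) (G : ℕ → ℕ → ℤ) (h : ℕ → ℤ) (i j k x : ℕ) (f : ℕ → ℕ) : Prop where
  path : BackPath G i j k x f
  value : h k = (j : ℤ) - x
  above : ∀ r, i ≤ r → r < k → (j : ℤ) - h r < f (r + 1)
  below : ∀ (r y : ℕ) g, k < r → j < R r → h r = (j : ℤ) - y → BackPath G i j r y g → g (k + 1) ≤ x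

/-- The change of a column of the hook tabloid. -/
def hookShift (h : ℕ → ℤ) (i j k x r : ℕ) : ℤ :=
  if i ≤ r ∧ r < k then h (r + 1) + 1 else if r = k then (j : ℤ) - x else h r

/-- The inverse of the change of a column of the hook tabloid. -/
def hookUnshift (h : ℕ → ℤ) (i k r : ℕ) : ℤ :=
  if r = i then 0 else if i < r ∧ r ≤ k then h (r - 1) - 1 else h r

section Shift

variable {R : ℕ → ℕ} {G G' : ℕ → ℕ → ℤ} {s : ℤ} {b i j k x m r c : ℕ} {f g : ℕ → ℕ} {h : ℕ → ℤ}

theorem shift_of_lt (h₁ : i ≤ r) (h₂ : r ≤ k) (h₃ : f r ≤ c) (h₄ : c < f (r + 1)) :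
    shift G s i k f r c = G r (c + 1) := by
  simp [shift, OnPath, h₁, h₂, h₃, h₄, h₄.le]

theorem shift_of_eq (hf : IsPath i j k x f) (h₁ : i ≤ r) (h₂ : r < k) (h₃ : c = f (r + 1)) :
    shift G s i k f r c = G (r + 1) c := by
  simp [shift, OnPath, h₁, h₂, h₂.le, h₃, hf.mono r h₁ h₂.le]

theorem shift_stop (hf : IsPath i j k x f) : shift G s i k f k x = s + x - k := by
  have := hf.mono k hf.le le_rfl
  rw [hf.finish] at this
  simp [shift, OnPath, hf.le, hf.finish, this]

theorem shift_of_not (h : ¬ OnPath i k f r c) : shift G s i k f r c = G r c := by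
  simp [shift, h]

theorem unshift_of_lt (h₁ : i ≤ r) (h₂ : r ≤ k) (h₃ : f r ≤ c) (h₄ : c < f (r + 1)) :
    unshift G s i k f r (c + 1) = G r c := by
  simp [unshift, OnPath, h₁, h₂, show f r ≤ c + 1 by omega, show c + 1 ≤ f (r + 1) by omega,
    show f r < c + 1 by omega]

theorem unshift_of_eq (hf : IsPath i j k x f) (h₁ : i ≤ r) (h₂ : r < k) (h₃ : c = f (r + 1)) :
    unshift G s i k f (r + 1) c = G r c := by
  have := hf.mono (r + 1) (by omega) (by omega)
  simp [unshift, OnPath, show i ≤ r + 1 by omega, show r + 1 ≤ k by omega, h₃, this,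
    show i < r + 1 by omega]

theorem unshift_start (hf : IsPath i j k x f) : unshift G s i k f i j = s + j - i := by
  have := hf.mono i le_rfl hf.le
  rw [hf.start] at this
  simp [unshift, OnPath, hf.le, hf.start, this]

theorem unshift_of_not (h : ¬ OnPath i k f r c) : unshift G s i k f r c = G r c := by
  simp [unshift, h]

theorem unshift_shift (hf : IsPath i j k x f) (hs : G i j = s + j - i) :
    unshift (shift G s i k f) s i k f = G := by
  ext r c
  by_cases hp : OnPath i k f r c
  · obtain ⟨h1, h2, h3, h4⟩ := hp
    rcases h3.eq_or_lt with rfl | hlt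
    · rcases h1.eq_or_lt with rfl | hlt'
      · rw [hf.start, unshift_start hf, hs]
      · obtain ⟨n, rfl⟩ : ∃ n, r = n + 1 := ⟨r - 1, by omega⟩
        rw [unshift_of_eq hf (by omega) (by omega) rfl, shift_of_eq hf (by omega) (by omega) rfl]
    · obtain ⟨c, rfl⟩ : ∃ n, c = n + 1 := ⟨c - 1, by omega⟩
      rw [unshift_of_lt h1 h2 (by omega) (by omega), shift_of_lt h1 h2 (by omega) (by omega)]
  · rw [unshift_of_not hp, shift_of_not hp]

theorem shift_unshift (hf : IsPath i j k x f) (hs : G k x = s + x - k) :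
    shift (unshift G s i k f) s i k f = G := by
  ext r c
  by_cases hp : OnPath i k f r c
  · obtain ⟨h1, h2, h3, h4⟩ := hp
    rcases h4.eq_or_lt with rfl | hlt
    · rcases h2.eq_or_lt with rfl | hlt'
      · rw [hf.finish, shift_stop hf, hs]
      · rw [shift_of_eq hf h1 hlt' rfl, unshift_of_eq hf h1 hlt' rfl]
    · rw [shift_of_lt h1 h2 h3 hlt, unshift_of_lt h1 h2 h3 hlt]
  · rw [shift_of_not hp, unshift_of_not hp]

theorem unshift_congr (h : ∀ r, i ≤ r → r ≤ k + 1 → f r = g r) :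
    unshift G s i k f = unshift G s i k g := by
  ext r c
  by_cases hr : i ≤ r ∧ r ≤ k
  · simp [unshift, OnPath, h r (by omega) (by omega), h (r + 1) (by omega) (by omega)]
    congr
  · have : ∀ f, ¬ OnPath i k f r c := fun f hp => hr ⟨hp.1, hp.2.1⟩
    rw [unshift_of_not (this _), unshift_of_not (this _)]

theorem hookUnshift_hookShift (hi : i ≤ k) (hh : h i = 0) :
    hookUnshift (hookShift h i j k x) i k = h := by
  ext r
  simp only [hookUnshift, hookShift]
  grind

theorem hookShift_hookUnshift (hi : i ≤ k) (hh : h k = (j : ℤ) - x) :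
    hookShift (hookUnshift h i k) i j k x = h := by
  ext r
  simp only [hookUnshift, hookShift]
  grind

/-- From row `i` on, column `j` is itself sorted: start with `one_le` there and gain at least one
per step to the right. This beats `lower` by one. -/
theorem Bounded.low (hb : Bounded R b j G) (hs : SortedFrom R i j G) (hr : i ≤ r) (hjc : j ≤ c)
    (hc : c < R r) : (c : ℤ) - j + 1 ≤ G r c := by
  induction c, hjc using Nat.le_induction with
  | base => simpa using hb.one_le r j hc le_rfl
  | succ n hn ih =>
    have := ih (by omega)
    have := hs.row r n ⟨by omega, by omega⟩ hc
    push_cast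
    omega

end Shift

/-! ### The effect of one sliding path on order, bounds, hooks and candidates. -/

section Forward

variable {R : ℕ → ℕ} {G G' : ℕ → ℕ → ℤ} {s : ℤ} {b i j k x m r c : ℕ} {f g : ℕ → ℕ} {h : ℕ → ℤ}

theorem FwdPath.end_le (hR : Antitone R) (hf : FwdPath R G s i j k x f) (h₁ : i ≤ r)
    (h₂ : r ≤ k) : f (r + 1) < R r :=
  (hf.le_stop (by omega) (by omega)).trans_lt (hf.mem.trans_le (hR h₂))

/-- The smaller of the right and bottom neighbours moves into the vacated cell, and a tie goes to
the right one; this is what strict rows and weak columns require. Where the special entry stops, it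
dominates the entries it has passed, and the stopping conditions compare it with its remaining
neighbours. -/
theorem FwdPath.sorted_shift (hR : Antitone R) (hf : FwdPath R G s i j k x f)
    (hs : SortedFrom R (i + 1) j G) : SortedFrom R i j (shift G s i k f) := by
  have hm := hf.mono
  have hE := fun r h₁ h₂ => hf.end_le (r := r) hR h₁ h₂
  have hstart := fun r h₁ h₂ => hf.start_le (r := r) h₁ h₂
  constructor
  · rintro r c ⟨hc, hrc⟩ hc'
    by_cases hp : OnPath i k f r c
    · obtain ⟨h1, h2, h3, h4⟩ := hp
      rcases h4.eq_or_lt with rfl | hlt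
      · rw [shift_of_not (r := r) (c := f (r + 1) + 1) (fun hp => by have := hp.2.2.2; omega)]
        rcases h2.eq_or_lt with rfl | hlt'
        · rw [hf.finish, shift_stop hf.toIsPath]
          exact hf.stop_right (hf.finish ▸ hc')
        · rw [shift_of_eq hf.toIsPath h1 hlt' rfl]
          exact hf.down' r _ h1 hlt' rfl hc'
      · rw [shift_of_lt h1 h2 h3 hlt]
        rcases (Nat.succ_le_of_lt hlt).eq_or_lt with heq | hlt2
        · rcases h2.eq_or_lt with rfl | hlt'
          · rw [← Nat.succ_eq_add_one, heq, hf.finish, shift_stop hf.toIsPath, ← hf.finish, ← heq]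
            have := hf.right r c h1 h2 h3 hlt
            rw [Nat.succ_eq_add_one]
            push_cast
            omega
          · rw [shift_of_eq hf.toIsPath h1 hlt' heq]
            have hE' := hE (r + 1) (by omega) (by omega)
            have hm' := hm (r + 1) (by omega) (by omega)
            exact (hf.right' r c h1 h2 h3 hlt (by omega)).trans_lt
              (hs.row (r + 1) c ⟨by omega, by omega⟩ (by omega))
        · rw [shift_of_lt h1 h2 (by omega) hlt2]
          have := hE r h1 h2
          exact hs.row r (c + 1) ⟨hc', by omega⟩ (by omega)
    · rw [shift_of_not hp]
      have hP : Processed R (i + 1) j r c := by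
        refine ⟨hc, ?_⟩
        rcases hrc with h | ⟨rfl, hir⟩
        · exact Or.inl h
        · refine Or.inr ⟨rfl, ?_⟩
          by_contra! hlt
          obtain rfl : r = i := by omega
          exact hp ⟨le_rfl, hf.le, hf.start.le, hstart (r + 1) (by omega) (by have := hf.le; omega)⟩
      have hlt := hs.row r c hP hc'
      by_cases hp' : OnPath i k f r (c + 1)
      · obtain ⟨h1, h2, h3, h4⟩ := hp'
        have hfc : f r = c + 1 := by
          by_contra hne
          exact hp ⟨h1, h2, by omega, by omega⟩
        rcases h4.eq_or_lt with heq | hlt'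
        · rcases h2.eq_or_lt with rfl | hlt2
          · rw [heq, hf.finish, shift_stop hf.toIsPath, ← hf.finish, ← heq]
            obtain ⟨n, rfl⟩ : ∃ n, r = n + 1 := ⟨r - 1, by
              have : r ≠ i := fun h => by
                have := hf.start
                rw [← h, hfc] at this
                rcases hrc with h | h <;> omega
              omega⟩
            have hni : i ≤ n := by
              by_contra hn
              obtain rfl : i = n + 1 := by omega
              have := hf.start
              rcases hrc with h | h <;> omega
            have := hf.down n (c + 1) hni (by omega) hfc
            push_cast at *
            omega
          · rw [shift_of_eq hf.toIsPath h1 hlt2 heq]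
            have hE' := hE (r + 1) (by omega) (by omega)
            have hm' := hm (r + 1) (by omega) (by omega)
            exact hlt.trans_le
              (hs.col r (c + 1) ⟨hc', by rcases hrc with h | h <;> omega⟩ (by omega))
        · rw [shift_of_lt h1 h2 h3 hlt']
          have := hE r h1 h2
          exact hlt.trans (hs.row r (c + 1) ⟨hc', by rcases hrc with h | h <;> omega⟩ (by omega))
      · rwa [shift_of_not hp']
  · rintro r c ⟨hc, hrc⟩ hc'
    by_cases hp : OnPath i k f r c
    · obtain ⟨h1, h2, h3, h4⟩ := hp
      rcases h4.eq_or_lt with rfl | hlt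
      · rcases h2.eq_or_lt with rfl | hlt'
        · rw [shift_of_not (r := r + 1) (fun hp => by have := hp.2.1; omega), hf.finish,
            shift_stop hf.toIsPath]
          exact hf.stop_down (hf.finish ▸ hc')
        · rw [shift_of_eq hf.toIsPath h1 hlt' rfl]
          have hm' := hm (r + 1) (by omega) (by omega)
          have hj := hstart (r + 1) (by omega) (by omega)
          rcases hm'.eq_or_lt with heq | hlt2
          · rcases (Nat.succ_le_of_lt hlt').eq_or_lt with hk | hk
            · have hx : f (r + 1) = x := by rw [heq, ← hf.finish, ← hk]
              rw [hx, show r + 1 = k from hk, shift_stop hf.toIsPath, ← hk, ← hx]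
              have := hf.down r _ h1 hlt' rfl
              rw [Nat.succ_eq_add_one]
              push_cast
              omega
            · rw [shift_of_eq hf.toIsPath (by omega) hk heq]
              have hE' := hE (r + 1 + 1) (by omega) (by omega)
              have hm2 := hm (r + 1 + 1) (by omega) (by omega)
              exact hs.col (r + 1) _ ⟨by omega, by omega⟩ (by omega)
          · rw [shift_of_lt (by omega) (by omega) le_rfl hlt2]
            have hE' := hE (r + 1) (by omega) (by omega)
            exact (hs.row (r + 1) _ ⟨by omega, by omega⟩ (by omega)).le
      · rw [shift_of_lt h1 h2 h3 hlt, shift_of_not fun hp => by have := hp.2.2.1; omega]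
        exact hf.right' r c h1 h2 h3 hlt hc'
    · rw [shift_of_not hp]
      have hP : Processed R (i + 1) j r c := by
        refine ⟨hc, ?_⟩
        rcases hrc with h | ⟨rfl, hir⟩
        · exact Or.inl h
        · refine Or.inr ⟨rfl, ?_⟩
          by_contra! hlt
          obtain rfl : r = i := by omega
          exact hp ⟨le_rfl, hf.le, hf.start.le, hstart (r + 1) (by omega) (by have := hf.le; omega)⟩
      have hle := hs.col r c hP hc'
      by_cases hp' : OnPath i k f (r + 1) c
      · obtain ⟨h1, h2, h3, h4⟩ := hp'
        have hj := hstart (r + 1) (by omega) (by omega)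
        have hne : i ≤ r → f (r + 1) ≠ c := by
          rintro hir rfl
          exact hp ⟨hir, by omega, hm r hir (by omega), le_rfl⟩
        have hlt : f (r + 1) < c ∨ r + 1 = i := by
          by_cases hir : i ≤ r
          · have := hne hir; omega
          · omega
        have hjc : j < c := by
          rcases hrc with h | h
          · exact h
          · rcases hlt with h' | h' <;> omega
        rcases h4.eq_or_lt with heq | hlt'
        · rcases h2.eq_or_lt with rfl | hlt2
          · have hx : c = x := heq.trans hf.finish
            subst hx
            rw [shift_stop hf.toIsPath]
            obtain ⟨n, rfl⟩ : ∃ n, c = n + 1 := ⟨c - 1, by omega⟩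
            have hfn : f (r + 1) ≤ n := by
              rcases hlt with h | h
              · omega
              · have := hf.start; rw [← h] at this; omega
            have := hf.right (r + 1) n h1 le_rfl hfn (by omega)
            push_cast at *
            omega
          · rw [shift_of_eq hf.toIsPath h1 hlt2 heq]
            have hE' := hE (r + 1 + 1) (by omega) (by omega)
            have hm2 := hm (r + 1 + 1) (by omega) (by omega)
            exact hle.trans (hs.col (r + 1) _ ⟨hc', by omega⟩ (by omega))
        · rw [shift_of_lt h1 h2 h3 hlt']
          have hE' := hE (r + 1) (by omega) (by omega)
          exact hle.trans (hs.row (r + 1) _ ⟨hc', by omega⟩ (by omega)).le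
      · rwa [shift_of_not hp']

theorem FwdPath.bounded_shift (hR : Antitone R) (hf : FwdPath R G s i j k x f)
    (hs : SortedFrom R (i + 1) j G) (hb : Bounded R b j G) (hG : G i j = s + j - i) :
    Bounded R b j (shift G s i k f) := by
  have hE := fun r h₁ h₂ => hf.end_le (r := r) hR h₁ h₂
  have hstart := fun r h₁ h₂ => hf.start_le (r := r) h₁ h₂
  have hik := hf.le
  have hR' : ∀ r, r ≤ k → x < R r := fun r hr => hf.mem.trans_le (hR hr)
  have hjx := hstart (k + 1) (by omega) le_rfl
  rw [hf.finish] at hjx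
  have hsb : s ≤ b := by
    have := hb.upper i j (hjx.trans_lt (hR' i hf.le))
    omega
  -- Each new entry on the path gains one over `lower`: it comes from the column to the right, or
  -- from a sorted row below, where `Bounded.low` applies, or it is the special entry, which
  -- dominates the last entry passed.
  have key : ∀ r c, OnPath i k f r c → (c : ℤ) - j + 1 ≤ shift G s i k f r c := by
    rintro r c ⟨h1, h2, h3, h4⟩
    have hj := hstart r h1 (by omega)
    have hEr := hE r h1 h2
    rcases h4.eq_or_lt with rfl | hlt
    · rcases h2.eq_or_lt with rfl | hlt'
      · rw [hf.finish, shift_stop hf.toIsPath]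
        rcases (hf.mono r h1 le_rfl).eq_or_lt with heq | hlt
        · rcases h1.eq_or_lt with rfl | hlt'
          · obtain rfl : j = x := by rw [← hf.start, ← hf.finish, heq]
            have := hb.one_le i j hf.mem le_rfl
            omega
          · obtain ⟨n, rfl⟩ : ∃ n, r = n + 1 := ⟨r - 1, by omega⟩
            have h5 := hf.down n x (by omega) (by omega) (by rw [heq, hf.finish])
            have h6 := hb.low hs (r := n + 1) (c := x) (by omega) hjx hf.mem
            push_cast
            omega
        · rw [hf.finish] at hlt
          obtain ⟨n, rfl⟩ : ∃ n, x = n + 1 := ⟨x - 1, by omega⟩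
          have h5 := hf.right r n (by omega) le_rfl (by omega) (by rw [hf.finish]; omega)
          have h6 := hb.lower r (n + 1) hf.mem (by omega)
          push_cast at *
          omega
      · rw [shift_of_eq hf.toIsPath h1 hlt' rfl]
        exact hb.low hs (by omega) (by omega)
          ((hf.le_stop (by omega) (by omega)).trans_lt (hR' _ hlt'))
    · rw [shift_of_lt h1 h2 h3 hlt]
      have := hb.lower r (c + 1) (by omega) (by omega)
      push_cast at this
      omega
  constructor
  · intro r c hc hcj
    by_cases hp : OnPath i k f r c
    · have := key r c hp
      have := hstart r hp.1 (by have := hp.2.1; omega)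
      have := hp.2.2.1
      omega
    · rw [shift_of_not hp]
      exact hb.one_le r c hc hcj
  · intro r c hc hjc
    by_cases hp : OnPath i k f r c
    · have := key r c hp
      omega
    · rw [shift_of_not hp]
      exact hb.lower r c hc hjc
  · intro r c hc
    by_cases hp : OnPath i k f r c
    · obtain ⟨h1, h2, h3, h4⟩ := hp
      rcases h4.eq_or_lt with rfl | hlt
      · rcases h2.eq_or_lt with rfl | hlt'
        · rw [hf.finish, shift_stop hf.toIsPath]
          omega
        · rw [shift_of_eq hf.toIsPath h1 hlt' rfl]
          have := hf.down r _ h1 hlt' rfl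
          omega
      · rw [shift_of_lt h1 h2 h3 hlt]
        have := hf.right r c h1 h2 h3 hlt
        omega
    · rw [shift_of_not hp]
      exact hb.upper r c hc

theorem FwdPath.hookRange_hookShift (hR : Antitone R) (hf : FwdPath R G s i j k x f)
    (hm : ∀ r, j < R r ↔ r < m) (hh : HookRange R m (i + 1) j h) :
    HookRange R m i j (hookShift h i j k x) := by
  intro r hir hjr
  have hjx := hf.start_le (r := k + 1) (by have := hf.le; omega) le_rfl
  rw [hf.finish] at hjx
  have hmem := hf.mem
  unfold hookShift
  split_ifs with h1 h2
  · have h3 := hR (show r + 1 ≤ k by omega)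
    have h4 := hR (show r ≤ r + 1 by omega)
    have h5 := hh (r + 1) (by omega) (by omega)
    push_cast at h5
    omega
  · subst h2
    have := (hm r).1 hjr
    omega
  · have := hf.le
    exact hh r (by omega) hjr

/-- At each cell of the path one compares an entry that has just moved with an unmoved one. The two
were neighbours in a column (left steps) or in a row (up steps) of the processed part of `G`, so
they compare in the required way. -/
theorem FwdPath.backPath_shift (hR : Antitone R) (hf : FwdPath R G s i j k x f)
    (hs : SortedFrom R (i + 1) j G) : BackPath (shift G s i k f) i j k x f := by
  have hE := fun r h₁ h₂ => hf.end_le (r := r) hR h₁ h₂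
  refine ⟨hf.toIsPath, ?_, ?_⟩
  · intro r c h1 h2 h3 h4
    have hj := hf.start_le (r := r + 1) h1 (by omega)
    have hEr := hE (r + 1) h1 h2
    have := hR (show r ≤ r + 1 by omega)
    rw [shift_of_lt h1 h2 h3 h4, shift_of_not fun hp => by have := hp.2.2.2; omega]
    exact hs.col r (c + 1) ⟨by omega, by omega⟩ (by omega)
  · intro r c h1 h2 h3 h4
    have hEr := hE (r + 1) (by omega) h2
    have := hf.mono (r + 1) (by omega) h2
    rw [shift_of_eq hf.toIsPath h1 (by omega) h3.symm, shift_of_not fun hp => by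
      have := hp.2.2.1; omega]
    exact hs.row (r + 1) c ⟨by omega, by omega⟩ (by omega)

/-- The reverse paths which end in column `j` below the start of a sliding path do not start to the
right of the sliding path. -/
theorem FwdPath.start_le_of_backPath (hR : Antitone R) (hf : FwdPath R G s i j k x f) {y : ℕ}
    (hg : BackPath G (i + 1) j r y g) {r' : ℕ} (h₁ : i + 1 ≤ r') (h₂ : r' ≤ r) (hk : r' ≤ k)
    (hyR : g (r' + 1) < R r') : g (r' + 1) ≤ f r' := by
  induction r', h₁ using Nat.le_induction with
  | base =>
    by_contra! hlt
    have h1 := hg.start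
    have h2 := hf.start_le (r := i + 1) (by omega) (by omega)
    have h3 := hg.left i (f (i + 1)) le_rfl (by omega) (by omega) hlt
    have h4 := hf.down' i _ le_rfl (by omega) rfl (by have := hR (show i ≤ i + 1 by omega); omega)
    omega
  | succ n hn ih =>
    by_contra! hlt
    have h0 := ih (by omega) (by omega) (by
      have := hg.mono (n + 1) (by omega) (by omega)
      have := hR (show n ≤ n + 1 by omega)
      omega)
    have h2 := hf.mono n (by omega) (by omega)
    have h3 := hg.left n (f (n + 1)) (by omega) (by omega) (by omega) hlt
    have h4 := hf.down' n _ (by omega) (by omega) rfl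
      (by have := hR (show n ≤ n + 1 by omega); omega)
    omega

/-- The old reverse paths are kept away from the sliding path by `FwdPath.start_le_of_backPath`; the
new ones are built with `exists_backPath`, the sliding path serving as a barrier. -/
theorem FwdPath.champion (hR : Antitone R) (hf : FwdPath R G s i j k x f)
    (hs : SortedFrom R (i + 1) j G) (hh : HookRange R m (i + 1) j h)
    (hg : Good R G (i + 1) j h) :
    Good R (shift G s i k f) i j (hookShift h i j k x) ∧
      Champion R (shift G s i k f) (hookShift h i j k x) i j k x f := by
  have hE := fun r h₁ h₂ => hf.end_le (r := r) hR h₁ h₂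
  have hB := hf.backPath_shift hR hs
  have hik := hf.le
  have hjx := hf.start_le (r := k + 1) (by omega) le_rfl
  rw [hf.finish] at hjx
  have hR' : ∀ r, r ≤ k → x < R r := fun r hr => hf.mem.trans_le (hR hr)
  -- If the old entry in row `r + 1` named a candidate, this lay weakly to the left of `f (r + 1)`.
  -- Adding one while moving the entry up shifts the named column one to the left, which makes the
  -- inequality strict.
  have above : ∀ r, i ≤ r → r < k → (j : ℤ) - hookShift h i j k x r < f (r + 1) := by
    intro r h1 h2
    have hj := hf.start_le (r := r + 1) (by omega) (by omega)
    rw [hookShift, if_pos ⟨h1, h2⟩]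
    by_cases hpos : 0 < h (r + 1)
    · omega
    · obtain ⟨y, hy⟩ : ∃ y : ℕ, h (r + 1) = (j : ℤ) - y :=
        ⟨((j : ℤ) - h (r + 1)).toNat, by omega⟩
      have hjR : j < R (r + 1) := hjx.trans_lt (hR' _ h2)
      obtain ⟨g, hgp⟩ := hg (r + 1) y (by omega) hjR (by omega) hy
      have h3 := hh (r + 1) (by omega) hjR
      have := hf.start_le_of_backPath hR hgp (r' := r + 1) (by omega) le_rfl h2
        (by rw [hgp.finish]; omega)
      rw [hgp.finish] at this
      omega
  have low : ∀ r y, i ≤ r → r ≤ k → j ≤ y → y ≤ f (r + 1) →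
      ∃ g, BackPath (shift G s i k f) i j r y g := by
    intro r y h1 h2 h3 h4
    obtain ⟨g, hg, -⟩ := exists_backPath hB.start (fun r h1 h2 => hB.start_le h1 h2) hB.left h1 h2
      h3 h4
    exact ⟨g, hg⟩
  have high : ∀ r y, k < r → j < R r → j ≤ y → h r = (j : ℤ) - y →
      ∃ g, BackPath (shift G s i k f) i j r y g ∧ g (k + 1) ≤ x := by
    intro r y h1 h2 h3 h4
    obtain ⟨g, hgp⟩ := hg r y (by omega) h2 h3 h4
    have hyR : y < R r := by
      have := hh r (by omega) h2
      omega
    have hgx : g (k + 1) ≤ x := by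
      rcases hik.eq_or_lt with rfl | hlt
      · rw [hgp.start]; exact hjx
      · refine (hf.start_le_of_backPath hR hgp hlt h1.le le_rfl ?_).trans
          (hf.le_stop (by omega) (by omega))
        exact (hgp.le_stop (by omega) (by omega)).trans_lt (hyR.trans_le (hR h1.le))
    -- The barrier is the old reverse path `g` below row `k`, continued by the sliding path from row
    -- `k` upwards. In row `k + 1` it uses only a part of the left steps of `g`, because `g (k + 1)
    -- ≤ x`.
    obtain ⟨g', hg', hle⟩ := exists_backPath (G := shift G s i k f) (i := i) (j := j) (k := r)
      (r := r) (y := y) (u := fun r => if r ≤ k + 1 then f r else g r)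
      (by simp [show i ≤ k + 1 by omega, hf.start])
      (fun r' h1 h2 => by
        split_ifs with h
        · exact hf.start_le h1 h
        · exact hgp.start_le (by omega) h2)
      (fun r' c h1 h2 h3 h4 => by
        by_cases hk : r' + 1 ≤ k
        · simp only [show r' + 1 ≤ k + 1 by omega, show r' + 1 + 1 ≤ k + 1 by omega, if_true]
            at h3 h4
          exact hB.left r' c h1 hk h3 h4
        · simp only [show ¬ r' + 1 + 1 ≤ k + 1 by omega, if_false] at h4
          have hgc : g (r' + 1) ≤ c := by
            split_ifs at h3 with h
            · obtain rfl : r' = k := by omega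
              rw [hf.finish] at h3
              omega
            · exact h3
          rw [shift_of_not (r := r' + 1) fun hp => hk hp.2.1, shift_of_not fun hp => by
            obtain ⟨a1, a2, a3, a4⟩ := hp
            obtain rfl : r' = k := by omega
            simp only [le_refl, if_true] at h3
            omega]
          exact hgp.left r' c (by omega) h2 hgc h4)
      (by omega) le_rfl h3 (by simp [show ¬ r + 1 ≤ k + 1 by omega, hgp.finish])
    refine ⟨g', hg', ?_⟩
    have := hle (k + 1) (by omega) (by omega)
    simpa [hf.finish] using this
  refine ⟨?_, ⟨hB, ?_, above, ?_⟩⟩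
  · intro r y h1 h2 h3 h4
    rcases lt_trichotomy r k with hlt | rfl | hlt
    · have := above r h1 hlt
      exact low r y h1 hlt.le h3 (by omega)
    · have : y = x := by
        simp only [hookShift, lt_irrefl, and_false, if_false, if_true] at h4
        omega
      exact low r y h1 le_rfl h3 (by rw [hf.finish, this])
    · rw [hookShift, if_neg (by omega), if_neg (by omega)] at h4
      obtain ⟨g, hg, -⟩ := high r y hlt h2 h3 h4
      exact ⟨g, hg⟩
  · simp [hookShift]
  · intro r y g h1 h2 h4 hgp
    rw [hookShift, if_neg (by omega), if_neg (by omega)] at h4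
    have h3 := hgp.start_le (r := r + 1) (by omega) le_rfl
    rw [hgp.finish] at h3
    obtain ⟨g', hg', hle⟩ := high r y h1 h2 h3 h4
    rwa [hgp.unique hg' (by omega) (by omega)]

end Forward

end HookContent

/-! ### Finding the champion and undoing a slide. -/

namespace HookContent

section Backward

variable {R : ℕ → ℕ} {G G' : ℕ → ℕ → ℤ} {s : ℤ} {b i j k k' x x' m r c : ℕ} {f g : ℕ → ℕ}
  {h : ℕ → ℤ}

/-- The rows are scanned from the bottom of the column upwards, and the path of the current record
holder is compared with the candidate in the next row. -/
theorem exists_champion (hm : ∀ r, j < R r ↔ r < m) (hh : HookRange R m i j h)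
    (hg : Good R G i j h) (him : i < m) :
    ∃ k x f, k < m ∧ Champion R G h i j k x f := by
  suffices H : ∀ d, d < m - i → ∃ k x f, m - 1 - d ≤ k ∧ k < m ∧ BackPath G i j k x f ∧
      h k = (j : ℤ) - x ∧ (∀ r, m - 1 - d ≤ r → r < k → (j : ℤ) - h r < f (r + 1)) ∧
      ∀ (r y : ℕ) g, k < r → j < R r → h r = (j : ℤ) - y → BackPath G i j r y g →
        g (k + 1) ≤ x by
    obtain ⟨k, x, f, h1, h2, h3, h4, h5, h6⟩ := H (m - 1 - i) (by omega)
    exact ⟨k, x, f, h2, h3, h4, fun r hr => h5 r (by omega), h6⟩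
  have cand : ∀ r, i ≤ r → r < m → h r ≤ 0 → ∃ (y : ℕ) (g : _), h r = (j : ℤ) - y ∧
      BackPath G i j r y g := by
    intro r h1 h2 h3
    obtain ⟨g, hg⟩ := hg r ((j : ℤ) - h r).toNat h1 ((hm r).2 h2) (by omega) (by omega)
    exact ⟨_, g, by omega, hg⟩
  intro d hd
  induction d with
  | zero =>
    -- The last row of the column always has a candidate, because the leg there is zero.
    obtain ⟨y, g, h1, h2⟩ := cand (m - 1) (by omega) (by omega)
      (by have := hh (m - 1) (by omega) ((hm _).2 (by omega)); omega)
    refine ⟨m - 1, y, g, by omega, by omega, h2, h1, by omega, ?_⟩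
    intro r _ _ hr hr'
    have := (hm r).1 hr'
    omega
  | succ d ih =>
    obtain ⟨k, x, f, h1, h2, h3, h4, h5, h6⟩ := ih (by omega)
    obtain ⟨n, hn⟩ : ∃ n, n = m - 1 - (d + 1) := ⟨_, rfl⟩
    rw [← hn]
    rw [show m - 1 - d = n + 1 by omega] at h1 h5
    have hj := h3.start_le (r := n + 1) (by omega) (by omega)
    by_cases hlt : (j : ℤ) - h n < f (n + 1)
    · refine ⟨k, x, f, by omega, h2, h3, h4, ?_, h6⟩
      intro r hr1 hr2
      rcases hr1.eq_or_lt with rfl | hr1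
      · exact hlt
      · exact h5 r hr1 hr2
    -- A candidate that is not strictly to the left of the record path takes over. By non-crossing,
    -- every reverse path from a lower row meets row `n` weakly to the left of the old record path,
    -- hence of the new candidate.
    · obtain ⟨y, g, hy, hg⟩ := cand n (by omega) (by omega) (by omega)
      refine ⟨n, y, g, le_rfl, by omega, hg, hy, by omega, ?_⟩
      intro r y' g' hr hjr hy' hg'
      have key : g' (n + 1) ≤ f (n + 1) := by
        rcases lt_trichotomy r k with hlt' | rfl | hlt'
        · refine hg'.le_of_le h3 (r := r + 1) (by omega) (by omega) (by omega) (by omega) ?_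
          rw [hg'.finish]
          have := h5 r (by omega) hlt'
          omega
        · obtain rfl : y' = x := by omega
          exact (hg'.unique h3 (by omega) (by omega)).le
        · refine hg'.le_of_le h3 (r := k + 1) (by omega) (by omega) (by omega) (by omega) ?_
          rw [h3.finish]
          exact h6 r y' g' hlt' hjr hy' hg'
      omega

/-- If one champion were in a higher row than another, `above` for the lower and `below` for the
higher would contradict each other in the higher row. -/
theorem Champion.unique (hf : Champion R G h i j k x f) (hg : Champion R G h i j k' x' g)
    (hk : j < R k) (hk' : j < R k') : k = k' ∧ x = x' := by
  have aux : ∀ {k k' x x' f g}, Champion R G h i j k x f → Champion R G h i j k' x' g →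
      j < R k' → ¬ k < k' := by
    intro k k' x x' f g hf hg hk' hlt
    have h1 := hg.above k hf.path.le hlt
    have h2 := hf.below k' x' g hlt hk' hg.value hg.path
    have h3 := hf.value
    omega
  have := aux hf hg hk'
  have := aux hg hf hk
  obtain rfl : k = k' := by omega
  have h1 := hf.value
  have h2 := hg.value
  exact ⟨rfl, by omega⟩

theorem SortedFrom.le_of_le (hR : Antitone R) (hs : SortedFrom R i j G) {r' c' : ℕ} (hr : i ≤ r)
    (hc : j ≤ c) (hrr : r ≤ r') (hcc : c ≤ c') (hmem : c' < R r') :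
    G r c + c' - c ≤ G r' c' := by
  have h1 : G r c + c' - c ≤ G r c' := by
    induction c', hcc using Nat.le_induction with
    | base => omega
    | succ n hn ih =>
      have := ih (by omega)
      have := hR hrr
      have := hs.row r n ⟨by omega, by omega⟩ (by omega)
      push_cast
      omega
  refine h1.trans ?_
  clear h1
  induction r', hrr using Nat.le_induction with
  | base => exact le_rfl
  | succ n hn ih =>
    have := hR (Nat.le_succ n)
    exact (ih (by rw [Nat.succ_eq_add_one] at this; omega)).trans
      (hs.col n c' ⟨by rw [Nat.succ_eq_add_one] at this; omega, by omega⟩ hmem)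

theorem BackPath.end_lt (hR : Antitone R) (hf : BackPath G i j k x f) (hx : x < R k)
    (h₁ : i ≤ r) (h₂ : r ≤ k) : f (r + 1) < R r :=
  (hf.le_stop (by omega) (by omega)).trans_lt (hx.trans_le (hR h₂))

/-- The larger of the left and upper neighbours is moved onto the path. The cell `(i, j)`, which
receives the special entry, is no longer counted as processed. -/
theorem BackPath.sorted_unshift (hR : Antitone R) (hf : BackPath G i j k x f) (hx : x < R k)
    (hs : SortedFrom R i j G) : SortedFrom R (i + 1) j (unshift G s i k f) := by
  have hm := hf.mono
  have hE := fun r h₁ h₂ => hf.end_lt (r := r) hR hx h₁ h₂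
  have hstart := fun r h₁ h₂ => hf.start_le (r := r) h₁ h₂
  constructor
  · rintro r c ⟨hc, hrc⟩ hc'
    by_cases hp : OnPath i k f r c
    · obtain ⟨h1, h2, h3, h4⟩ := hp
      have hj := hstart r h1 (by omega)
      -- Except at the start of the path, an entry is replaced by its old left or upper neighbour,
      -- which is not larger.
      have hlast : unshift G s i k f r c ≤ G r c := by
        rcases h3.eq_or_lt with heq | hlt
        · obtain ⟨n, rfl⟩ : ∃ n, r = n + 1 := ⟨r - 1, by
            have : r ≠ i := fun h => by
              have := hf.start
              rw [← h] at this
              omega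
            omega⟩
          have hni : i ≤ n := by
            by_contra hn
            obtain rfl : i = n + 1 := by omega
            have := hf.start
            omega
          rw [unshift_of_eq hf.toIsPath hni (by omega) heq.symm]
          have := hR (Nat.le_succ n)
          exact hs.col n c ⟨by rw [Nat.succ_eq_add_one] at this; omega, by omega⟩ hc
        · obtain ⟨c, rfl⟩ : ∃ n, c = n + 1 := ⟨c - 1, by omega⟩
          rw [unshift_of_lt h1 h2 (by omega) (by omega)]
          exact (hs.row r c ⟨by omega, by omega⟩ hc).le
      rcases h4.eq_or_lt with heq | hlt
      · rw [unshift_of_not (c := c + 1) fun hp => by have := hp.2.2.2; omega]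
        exact hlast.trans_lt (hs.row r c ⟨hc, by omega⟩ hc')
      · rw [unshift_of_lt h1 h2 h3 hlt]
        rcases h3.eq_or_lt with heq | hlt'
        · obtain ⟨n, rfl⟩ : ∃ n, r = n + 1 := ⟨r - 1, by
            have : r ≠ i := fun h => by
              have := hf.start
              rw [← h] at this
              omega
            omega⟩
          have hni : i ≤ n := by
            by_contra hn
            obtain rfl : i = n + 1 := by omega
            have := hf.start
            omega
          rw [unshift_of_eq hf.toIsPath hni (by omega) heq.symm]
          have := hR (Nat.le_succ n)
          rw [Nat.succ_eq_add_one] at this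
          exact (hs.row n c ⟨by omega, by omega⟩ (by omega)).trans_le
            (hf.left n c (by omega) h2 heq.le hlt)
        · obtain ⟨c, rfl⟩ : ∃ n, c = n + 1 := ⟨c - 1, by omega⟩
          rw [unshift_of_lt h1 h2 (by omega) (by omega)]
          exact hs.row r c ⟨by omega, by omega⟩ hc
    · rw [unshift_of_not hp]
      by_cases hp' : OnPath i k f r (c + 1)
      · obtain ⟨h1, h2, h3, h4⟩ := hp'
        have hfc : f r = c + 1 := by
          by_contra hne
          exact hp ⟨h1, h2, by omega, by omega⟩
        have hri : r ≠ i := fun h => by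
          have := hf.start
          rw [← h] at this
          omega
        obtain ⟨n, rfl⟩ : ∃ n, r = n + 1 := ⟨r - 1, by omega⟩
        rw [unshift_of_eq hf.toIsPath (by omega) (by omega) hfc.symm]
        exact hf.up n c (by omega) h2 hfc (by omega)
      · rw [unshift_of_not hp']
        exact hs.row r c ⟨hc, by omega⟩ hc'
  · rintro r c ⟨hc, hrc⟩ hc'
    by_cases hp : OnPath i k f r c
    · obtain ⟨h1, h2, h3, h4⟩ := hp
      have hj := hstart r h1 (by omega)
      have hlast : unshift G s i k f r c ≤ G r c := by
        rcases h3.eq_or_lt with heq | hlt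
        · obtain ⟨n, rfl⟩ : ∃ n, r = n + 1 := ⟨r - 1, by
            have : r ≠ i := fun h => by
              have := hf.start
              rw [← h] at this
              omega
            omega⟩
          have hni : i ≤ n := by
            by_contra hn
            obtain rfl : i = n + 1 := by omega
            have := hf.start
            omega
          rw [unshift_of_eq hf.toIsPath hni (by omega) heq.symm]
          have := hR (Nat.le_succ n)
          exact hs.col n c ⟨by rw [Nat.succ_eq_add_one] at this; omega, by omega⟩ hc
        · obtain ⟨c, rfl⟩ : ∃ n, c = n + 1 := ⟨c - 1, by omega⟩
          rw [unshift_of_lt h1 h2 (by omega) (by omega)]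
          exact (hs.row r c ⟨by omega, by omega⟩ hc).le
      by_cases hp' : OnPath i k f (r + 1) c
      · obtain ⟨a1, a2, a3, a4⟩ := hp'
        rwa [unshift_of_eq hf.toIsPath h1 (by omega) (by omega)]
      · rw [unshift_of_not hp']
        exact hlast.trans (hs.col r c ⟨hc, by omega⟩ hc')
    · rw [unshift_of_not hp]
      by_cases hp' : OnPath i k f (r + 1) c
      · obtain ⟨h1, h2, h3, h4⟩ := hp'
        have hj := hstart (r + 1) h1 (by omega)
        have hlt : f (r + 1) < c := by
          rcases h3.eq_or_lt with heq | hlt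
          · by_cases hir : i ≤ r
            · exact absurd ⟨hir, by omega, by have := hm r hir (by omega); omega, by omega⟩ hp
            · have := hf.start
              rw [show i = r + 1 by omega] at this
              omega
          · exact hlt
        obtain ⟨c, rfl⟩ : ∃ n, c = n + 1 := ⟨c - 1, by omega⟩
        rw [unshift_of_lt h1 h2 (by omega) (by omega)]
        exact hf.left r c h1 h2 (by omega) (by omega)
      · rw [unshift_of_not hp']
        exact hs.col r c ⟨hc, by omega⟩ hc'

/-- All cells of the path lie weakly above and to the left of `(k, x)`, so sortedness makes the
special entry large enough to pass every entry on the path. The choices between right and down come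
from adjacent entries of the sorted grid. -/
theorem BackPath.fwdPath_unshift (hR : Antitone R) (hf : BackPath G i j k x f) (hx : x < R k)
    (hs : SortedFrom R i j G) (hG : G k x = s + x - k) :
    FwdPath R (unshift G s i k f) s i j k x f := by
  have hm := hf.mono
  have hE := fun r h₁ h₂ => hf.end_lt (r := r) hR hx h₁ h₂
  have hstart := fun r h₁ h₂ => hf.start_le (r := r) h₁ h₂
  have hjx := hstart (k + 1) (by have := hf.le; omega) le_rfl
  rw [hf.finish] at hjx
  refine ⟨hf.toIsPath, hx, ?_, ?_, ?_, ?_, ?_, ?_⟩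
  · intro r c h1 h2 h3 h4
    rw [unshift_of_lt h1 h2 h3 h4]
    have hj := hstart r h1 (by omega)
    have hcx := hf.le_stop (r := r + 1) (by omega) (by omega)
    have := hs.le_of_le hR h1 (hj.trans h3) h2 (h4.le.trans hcx) hx
    omega
  · intro r c h1 h2 h3 h4 h5
    have hj := hstart r h1 (by omega)
    have := hE r h1 h2
    rw [unshift_of_lt h1 h2 h3 h4, unshift_of_not fun hp => by have := hp.2.2.1; omega]
    exact hs.col r c ⟨by omega, by omega⟩ h5
  · intro r c h1 h2 h3
    have hj := hstart (r + 1) (by omega) (by omega)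
    have hcx := hf.le_stop (r := r + 1) (by omega) (by omega)
    rw [unshift_of_eq hf.toIsPath h1 h2 h3.symm]
    have := hs.le_of_le hR h1 (c := c) (by omega) h2.le (c' := x) (by omega) hx
    omega
  · intro r c h1 h2 h3 h4
    have hj := hstart (r + 1) (by omega) (by omega)
    rw [unshift_of_eq hf.toIsPath h1 h2 h3.symm, unshift_of_not fun hp => by
      have := hp.2.2.2; omega]
    exact hs.row r c ⟨by omega, by omega⟩ h4
  · intro h
    rw [unshift_of_not fun hp => by have := hp.2.2.2; have := hf.finish; omega, ← hG]
    exact hs.row k x ⟨hx, by have := hf.le; omega⟩ h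
  · intro h
    rw [unshift_of_not fun hp => by have := hp.2.1; omega, ← hG]
    exact hs.col k x ⟨hx, by have := hf.le; omega⟩ h

theorem BackPath.bounded_unshift (hR : Antitone R) (hf : BackPath G i j k x f) (hx : x < R k)
    (hs : SortedFrom R i j G) (hb : Bounded R b j G) (hG : G k x = s + x - k) :
    Bounded R b j (unshift G s i k f) := by
  have hE := fun r h₁ h₂ => hf.end_lt (r := r) hR hx h₁ h₂
  have hstart := fun r h₁ h₂ => hf.start_le (r := r) h₁ h₂
  have hik := hf.le
  have hjx := hstart (k + 1) (by omega) le_rfl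
  rw [hf.finish] at hjx
  have hsb := hb.upper k x hx
  have hs1 := hb.low hs hik hjx hx
  have key : ∀ r c, OnPath i k f r c → c < R r → (c : ℤ) - j ≤ unshift G s i k f r c ∧
      (c = j → 1 ≤ unshift G s i k f r c) ∧ unshift G s i k f r c ≤ b + c - r := by
    rintro r c ⟨h1, h2, h3, h4⟩ hc
    have hj := hstart r h1 (by omega)
    rcases h3.eq_or_lt with heq | hlt
    · rcases h1.eq_or_lt with rfl | hlt
      · rw [hf.start] at heq
        rw [← heq, unshift_start hf.toIsPath]
        omega
      · obtain ⟨n, rfl⟩ : ∃ n, r = n + 1 := ⟨r - 1, by omega⟩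
        rw [unshift_of_eq hf.toIsPath (by omega) (by omega) heq.symm]
        have := hR (Nat.le_succ n)
        rw [Nat.succ_eq_add_one] at this
        have h5 := hb.low hs (r := n) (c := c) (by omega) (by omega) (by omega)
        have h6 := hs.col n c ⟨by omega, by omega⟩ hc
        have h7 := hb.upper (n + 1) c hc
        omega
    · obtain ⟨c, rfl⟩ : ∃ n, c = n + 1 := ⟨c - 1, by omega⟩
      rw [unshift_of_lt h1 h2 (by omega) (by omega)]
      have h5 := hb.low hs (r := r) (c := c) (by omega) (by omega) (by omega)
      have h7 := hb.upper r c (by omega)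
      push_cast
      omega
  constructor
  · intro r c hc hcj
    by_cases hp : OnPath i k f r c
    · have := hstart r hp.1 (by have := hp.2.1; omega)
      have := hp.2.2.1
      exact (key r c hp hc).2.1 (by omega)
    · rw [unshift_of_not hp]
      exact hb.one_le r c hc hcj
  · intro r c hc hjc
    by_cases hp : OnPath i k f r c
    · exact (key r c hp hc).1
    · rw [unshift_of_not hp]
      exact hb.lower r c hc hjc
  · intro r c hc
    by_cases hp : OnPath i k f r c
    · exact (key r c hp hc).2.2
    · rw [unshift_of_not hp]
      exact hb.upper r c hc

/-- The entry moved down by one row and lowered by one must still respect the arm in the possibly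
shorter row below. It does, because `above` places the old candidate strictly to the left of the
champion's path, which lies inside the diagram. -/
theorem Champion.hookRange_hookUnshift (hR : Antitone R) (hf : Champion R G h i j k x f)
    (hx : x < R k) (hh : HookRange R m i j h) :
    HookRange R m (i + 1) j (hookUnshift h i k) := by
  intro r hir hjr
  unfold hookUnshift
  rw [if_neg (by omega)]
  split_ifs with h1
  · obtain ⟨n, rfl⟩ : ∃ n, r = n + 1 := ⟨r - 1, by omega⟩
    have h2 := hf.above n (by omega) (by omega)
    have h3 := hf.path.end_lt hR hx (r := n + 1) (by omega) (by omega)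
    have h4 := hf.path.mono (n + 1) (by omega) (by omega)
    have h5 := hh n (by omega) (hjr.trans_le (hR (Nat.le_succ n)))
    rw [Nat.add_sub_cancel]
    push_cast
    omega
  · exact hh r (by omega) hjr

/-- After the slide has been undone, the champion's path moved down by one row permits all its left
steps (`inner`), so it is a barrier for reverse paths that must stop at row `i + 1`. -/
theorem Champion.good_hookUnshift (hR : Antitone R) (hf : Champion R G h i j k x f)
    (hx : x < R k) (hs : SortedFrom R i j G) (hh : HookRange R m i j h) (hg : Good R G i j h) :
    Good R (unshift G s i k f) (i + 1) j (hookUnshift h i k) := by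
  have hp := hf.path
  have hm := hp.mono
  have hik := hp.le
  have hstart := fun r h₁ h₂ => hp.start_le (r := r) h₁ h₂
  have inner : ∀ r c, i ≤ r → r ≤ k → f r ≤ c → c < f (r + 1) → c < R (r + 1) →
      unshift G s i k f r (c + 1) ≤ unshift G s i k f (r + 1) c := by
    intro r c h1 h2 h3 h4 h5
    have := hstart r h1 (by omega)
    rw [unshift_of_lt h1 h2 h3 h4, unshift_of_not fun hp => by have := hp.2.2.1; omega]
    exact hs.col r c ⟨h5.trans_le (hR (Nat.le_succ r)), by omega⟩ h5
  intro r y h1 h2 h3 h4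
  unfold hookUnshift at h4
  rw [if_neg (by omega)] at h4
  by_cases hrk : r ≤ k
  · rw [if_pos ⟨by omega, hrk⟩] at h4
    obtain ⟨n, rfl⟩ : ∃ n, r = n + 1 := ⟨r - 1, by omega⟩
    have h5 := hf.above n (by omega) (by omega)
    rw [Nat.add_sub_cancel] at h4
    -- The shift `r - 1` moves `f` down by one row; the lowered hook entry moves the candidate one
    -- row down and one column to the right, so the strict inequality in `above` keeps it within the
    -- barrier.
    obtain ⟨g, hg, -⟩ := exists_backPath (G := unshift G s i k f) (i := i + 1) (j := j) (k := k)
      (r := n + 1) (y := y) (u := fun r => f (r - 1)) (by simpa using hp.start)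
      (fun r h1 h2 => hstart (r - 1) (by omega) (by omega))
      (fun r c h1 h2 h3 h4 => by
        rw [Nat.add_sub_cancel] at h3 h4
        refine inner r c (by omega) (by omega) h3 h4 ?_
        have := hp.end_lt hR hx (r := r + 1) (by omega) h2
        have := hm (r + 1) (by omega) h2
        omega)
      h1 hrk h3 (by rw [Nat.add_sub_cancel]; omega)
    exact ⟨g, hg⟩
  · rw [if_neg (by omega)] at h4
    obtain ⟨g, hgp⟩ := hg r y (by omega) h2 h3 h4
    have hgx := hf.below r y g (by omega) h2 h4 hgp
    have hyR : y < R r := by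
      have := hh r (by omega) h2
      omega
    -- Below row `k + 1` the barrier is `g`. In row `k + 1` itself, columns before `f (k + 1)` are
    -- handled by `inner`, the others by the left steps of `g`.
    obtain ⟨g', hg', -⟩ := exists_backPath (G := unshift G s i k f) (i := i + 1) (j := j) (k := r)
      (r := r) (y := y) (u := fun r => if r ≤ k + 1 then f (r - 1) else g r)
      (by simp [show i ≤ k by omega, hp.start])
      (fun r' h1 h2 => by
        split_ifs with h
        · exact hstart _ (by omega) (by omega)
        · exact hgp.start_le (by omega) h2)
      (fun r' c h1 h2 h3 h4 => by
        simp only [Nat.add_sub_cancel] at h3 h4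
        by_cases hk : r' + 1 ≤ k
        · simp only [show r' + 1 ≤ k + 1 by omega, show r' + 1 + 1 ≤ k + 1 by omega, if_true]
            at h3 h4
          refine inner r' c (by omega) (by omega) h3 h4 ?_
          have := hp.end_lt hR hx (r := r' + 1) (by omega) hk
          have := hm (r' + 1) (by omega) hk
          omega
        · simp only [show ¬ r' + 1 + 1 ≤ k + 1 by omega, if_false] at h4
          by_cases hin : r' = k ∧ c < f (r' + 1)
          · obtain ⟨rfl, hc⟩ := hin
            rw [if_pos le_rfl] at h3
            refine inner r' c (by omega) le_rfl h3 hc ?_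
            have := hgp.le_stop (r := r' + 1 + 1) (by omega) (by omega)
            have := hR h2
            omega
          · have hgc : g (r' + 1) ≤ c := by
              split_ifs at h3 with h
              · obtain rfl : r' = k := by omega
                have := hp.finish
                omega
              · exact h3
            rw [unshift_of_not (r := r' + 1) fun hp => hk hp.2.1, unshift_of_not fun hp => by
              obtain ⟨a1, a2, a3, a4⟩ := hp
              omega]
            exact hgp.left r' c (by omega) h2 hgc h4)
      h1 le_rfl h3 (by simp [show ¬ r ≤ k by omega, hgp.finish])
    exact ⟨g', hg'⟩

end Backward

end HookContent

/-! ### Translation between fillings and grids; the algorithm follows the sliding path. -/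

namespace HookContent

variable {μ : YoungDiagram}

/-- The entries of a filling increased by the contents, as a function of row and column. -/
def toGrid (T : Filling μ) (r c : ℕ) : ℤ := if h : (r, c) ∈ μ then T ⟨(r, c), h⟩ + c - r else 0

/-- The filling of `μ` with the entries of a grid decreased by the contents. -/
def ofGrid (G : ℕ → ℕ → ℤ) : Filling μ := fun p => G p.row p.col + p.row - p.col

theorem rowLen_antitone (μ : YoungDiagram) : Antitone μ.rowLen := fun _ _ h => μ.rowLen_anti _ _ h

theorem mem_iff {r c : ℕ} : (r, c) ∈ μ ↔ c < μ.rowLen r := YoungDiagram.mem_iff_lt_rowLen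

theorem toGrid_cell (T : Filling μ) (p : Cell μ) : toGrid T p.row p.col = T p + p.col - p.row := by
  rw [toGrid, dif_pos p.2]

theorem ofGrid_toGrid (T : Filling μ) : ofGrid (toGrid T) = T := by
  ext p
  rw [ofGrid, toGrid_cell]
  ring

theorem toGrid_ofGrid (G : ℕ → ℕ → ℤ) {r c : ℕ} (h : c < μ.rowLen r) :
    toGrid (ofGrid G : Filling μ) r c = G r c := by
  rw [toGrid, dif_pos (mem_iff.2 h), ofGrid]
  ring

theorem rightOf_eq_some {p q : Cell μ} : rightOf p = some q ↔ q.1 = (p.row, p.col + 1) := by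
  unfold rightOf
  constructor
  · intro h
    split_ifs at h with hm
    rw [← Option.some.inj h]
  · intro h
    rw [dif_pos (h ▸ q.2)]
    exact congrArg some (Subtype.ext h.symm)

theorem below_eq_some {p q : Cell μ} : below p = some q ↔ q.1 = (p.row + 1, p.col) := by
  unfold below
  constructor
  · intro h
    split_ifs at h with hm
    rw [← Option.some.inj h]
  · intro h
    rw [dif_pos (h ▸ q.2)]
    exact congrArg some (Subtype.ext h.symm)

theorem rightOf_eq_none {p : Cell μ} : rightOf p = none ↔ ¬ p.col + 1 < μ.rowLen p.row := by
  simp [rightOf, mem_iff]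

theorem below_eq_none {p : Cell μ} : below p = none ↔ ¬ p.col < μ.rowLen (p.row + 1) := by
  simp [below, mem_iff]

/-- The condition for the special entry to stop, in terms of the grid. -/
theorem stopHC_iff (T : Filling μ) (p : Cell μ) :
    ((T p : WithTop ℤ) ≤ topEntry T (rightOf p) ∧ (T p : WithTop ℤ) < topEntry T (below p)) ↔
      (p.col + 1 < μ.rowLen p.row →
        T p + p.col - p.row < toGrid T p.row (p.col + 1)) ∧
      (p.col < μ.rowLen (p.row + 1) →
        T p + p.col - p.row ≤ toGrid T (p.row + 1) p.col) := by
  refine and_congr ?_ ?_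
  · by_cases h : p.col + 1 < μ.rowLen p.row
    · have hm := mem_iff.2 h
      rw [rightOf_eq_some (q := ⟨_, hm⟩) |>.2 rfl]
      simp only [topEntry, WithTop.coe_le_coe, h, true_imp_iff, toGrid, dif_pos hm]
      push_cast
      constructor <;> intro <;> linarith
    · rw [rightOf_eq_none.2 h]
      simp [topEntry, h]
  · by_cases h : p.col < μ.rowLen (p.row + 1)
    · have hm := mem_iff.2 h
      rw [below_eq_some (q := ⟨_, hm⟩) |>.2 rfl]
      simp only [topEntry, WithTop.coe_lt_coe, h, true_imp_iff, toGrid, dif_pos hm]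
      push_cast
      constructor <;> intro <;> linarith
    · rw [below_eq_none.2 h]
      simp [topEntry, h]

/-- The condition for a move to the right, in terms of the grid. -/
theorem rightHC_iff (T : Filling μ) (p : Cell μ) :
    (topEntry T (rightOf p) + 1 < topEntry T (below p)) ↔
      p.col + 1 < μ.rowLen p.row ∧ (p.col < μ.rowLen (p.row + 1) →
        toGrid T p.row (p.col + 1) ≤ toGrid T (p.row + 1) p.col) := by
  by_cases h : p.col + 1 < μ.rowLen p.row
  · have hm := mem_iff.2 h
    rw [rightOf_eq_some (q := ⟨_, hm⟩) |>.2 rfl]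
    by_cases h' : p.col < μ.rowLen (p.row + 1)
    · have hm' := mem_iff.2 h'
      rw [below_eq_some (q := ⟨_, hm'⟩) |>.2 rfl]
      simp only [topEntry, h, h', true_imp_iff, true_and, toGrid, dif_pos hm, dif_pos hm']
      rw [← WithTop.coe_one, ← WithTop.coe_add, WithTop.coe_lt_coe]
      push_cast
      constructor <;> intro <;> linarith
    · rw [below_eq_none.2 h']
      simp only [topEntry, h, h', false_imp_iff, and_true, iff_true]
      rw [← WithTop.coe_one, ← WithTop.coe_add]
      exact WithTop.coe_lt_top _
  · rw [rightOf_eq_none.2 h]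
    simp [topEntry, h]

theorem slideHC_right {T : Filling μ} {p q : Cell μ}
    (h₁ : ¬ ((T p : WithTop ℤ) ≤ topEntry T (rightOf p) ∧ (T p : WithTop ℤ) < topEntry T (below p)))
    (h₂ : topEntry T (rightOf p) + 1 < topEntry T (below p)) (hq : rightOf p = some q) :
    slideHC T p = slideHC (Function.update (Function.update T p (T q + 1)) q (T p)) q := by
  rw [slideHC, if_neg h₁, if_pos h₂]
  split
  · rename_i q' h
    obtain rfl : q' = q := Option.some.inj (h.symm.trans hq)
    rfl
  · rename_i h
    rw [hq] at h
    cases h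

theorem slideHC_down {T : Filling μ} {p q : Cell μ}
    (h₁ : ¬ ((T p : WithTop ℤ) ≤ topEntry T (rightOf p) ∧ (T p : WithTop ℤ) < topEntry T (below p)))
    (h₂ : ¬ topEntry T (rightOf p) + 1 < topEntry T (below p)) (hq : below p = some q) :
    slideHC T p = slideHC (Function.update (Function.update T p (T q - 1)) q (T p)) q := by
  rw [slideHC, if_neg h₁, if_neg h₂]
  split
  · rename_i q' h
    obtain rfl : q' = q := Option.some.inj (h.symm.trans hq)
    rfl
  · rename_i h
    rw [hq] at h
    cases h

theorem toGrid_update (T : Filling μ) (p : Cell μ) (v : ℤ) (r c : ℕ) :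
    toGrid (Function.update T p v) r c =
      if r = p.row ∧ c = p.col then v + c - r else toGrid T r c := by
  by_cases h : (r, c) ∈ μ
  · simp only [toGrid, dif_pos h, Function.update_apply, Subtype.ext_iff, Prod.ext_iff]
    split_ifs <;> rfl
  · rw [toGrid, dif_neg h, toGrid, dif_neg h, if_neg]
    rintro ⟨rfl, rfl⟩
    exact h p.2

theorem toGrid_injective : Function.Injective (toGrid : Filling μ → ℕ → ℕ → ℤ) := fun S T h => by
  rw [← ofGrid_toGrid S, h, ofGrid_toGrid]

theorem toGrid_eq_zero (T : Filling μ) {r c : ℕ} (h : ¬ c < μ.rowLen r) : toGrid T r c = 0 :=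
  dif_neg fun hm => h (mem_iff.1 hm)

section Tail

variable {R : ℕ → ℕ} {G G' : ℕ → ℕ → ℤ} {s : ℤ} {i j k x : ℕ} {f : ℕ → ℕ}

/-- Induction step for a first move to the right. The value of `G'` in the new special cell is left
free, since the path conditions use `s` there. -/
theorem FwdPath.tail_right (hf : FwdPath R G s i j k x f) (hlt : j < f (i + 1))
    (hG : ∀ r c, ¬ (r = i ∧ (c = j ∨ c = j + 1)) → G' r c = G r c) (h₀ : G' i j = G i (j + 1)) :
    FwdPath R G' s i (j + 1) k x (Function.update f i (j + 1)) ∧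
      shift G' s i k (Function.update f i (j + 1)) = shift G s i k f := by
  have hst := hf.start
  have hle := hf.le
  have hu : ∀ r, i < r → Function.update f i (j + 1) r = f r := fun r hr =>
    Function.update_of_ne (by omega) _ _
  have hu' : ∀ r c, i ≤ r → (Function.update f i (j + 1) r ≤ c ↔ f r ≤ c ∧
      (r = i → j + 1 ≤ c)) := by
    intro r c hr
    rcases hr.eq_or_lt with rfl | hr
    · rw [Function.update_self]
      omega
    · rw [hu r hr]
      omega
  have hj := fun r h₁ h₂ => hf.start_le (r := r) h₁ h₂
  have hp : IsPath i (j + 1) k x (Function.update f i (j + 1)) := by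
    refine ⟨hle, Function.update_self .., ?_, ?_⟩
    · rw [hu _ (by omega), hf.finish]
    · intro r hr1 hr2
      rw [hu (r + 1) (by omega), hu' r _ hr1]
      exact ⟨hf.mono r hr1 hr2, fun h => by subst h; exact hlt⟩
  constructor
  · refine ⟨hp, hf.mem, ?_, ?_, ?_, ?_, ?_, ?_⟩
    · intro r c hr1 hr2 hr3 hr4
      rw [hu (r + 1) (by omega)] at hr4
      obtain ⟨h5, h6⟩ := (hu' r c hr1).1 hr3
      rw [hG _ _ (by omega)]
      exact hf.right r c hr1 hr2 h5 hr4
    · intro r c hr1 hr2 hr3 hr4 hr5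
      rw [hu (r + 1) (by omega)] at hr4
      obtain ⟨h5, h6⟩ := (hu' r c hr1).1 hr3
      rw [hG _ _ (by omega), hG _ _ (by omega)]
      exact hf.right' r c hr1 hr2 h5 hr4 hr5
    · intro r c hr1 hr2 hr3
      rw [hu (r + 1) (by omega)] at hr3
      rw [hG _ _ (by omega)]
      exact hf.down r c hr1 hr2 hr3
    · intro r c hr1 hr2 hr3 hr4
      rw [hu (r + 1) (by omega)] at hr3
      have := hj (r + 1) (by omega) (by omega)
      have : r = i → j < c := by rintro rfl; omega
      rw [hG _ _ (by omega), hG _ _ (by omega)]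
      exact hf.down' r c hr1 hr2 hr3 hr4
    · intro h
      have := hf.le_stop (r := i + 1) (by omega) (by omega)
      rw [hG _ _ (by omega)]
      exact hf.stop_right h
    · intro h
      rw [hG _ _ (by omega)]
      exact hf.stop_down h
  · ext r c
    by_cases ho : OnPath i k f r c
    · obtain ⟨h1, h2, h3, h4⟩ := ho
      have hne : r = i → c = f (r + 1) → j < c := by rintro rfl rfl; exact hlt
      rcases h4.eq_or_lt with heq | hlt'
      · rcases h2.eq_or_lt with rfl | hlt2
        · obtain rfl : c = x := heq.trans hf.finish
          rw [shift_stop hp, shift_stop hf.toIsPath]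
        · rw [shift_of_eq hf.toIsPath h1 hlt2 heq, shift_of_eq hp h1 hlt2
            (by rw [hu _ (by omega), heq]), hG _ _ (by omega)]
      · rw [shift_of_lt h1 h2 h3 hlt']
        by_cases hij : r = i ∧ c = j
        · obtain ⟨rfl, rfl⟩ := hij
          rw [shift_of_not fun h => by
            have := ((hu' _ _ le_rfl).1 h.2.2.1).2 rfl
            omega, h₀]
        · have : r = i → j ≤ c := by rintro rfl; omega
          rw [shift_of_lt h1 h2 ((hu' r c h1).2 ⟨h3, by omega⟩) (by rwa [hu _ (by omega)]),
            hG _ _ (by omega)]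
    · rw [shift_of_not ho, shift_of_not fun h => by
        obtain ⟨h1, h2, h3, h4⟩ := h
        rw [hu _ (by omega)] at h4
        exact ho ⟨h1, h2, ((hu' r c h1).1 h3).1, h4⟩]
      refine hG r c ?_
      rintro ⟨rfl, h⟩
      exact ho ⟨le_rfl, hle, by omega, by omega⟩

theorem FwdPath.tail_down (hf : FwdPath R G s i j k x f) (hj : f (i + 1) = j)
    (hlt : i < k) (hG : ∀ r c, ¬ (c = j ∧ (r = i ∨ r = i + 1)) → G' r c = G r c)
    (h₀ : G' i j = G (i + 1) j) :
    FwdPath R G' s (i + 1) j k x f ∧ shift G' s (i + 1) k f = shift G s i k f := by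
  have hst := hf.start
  have hle := hf.le
  have hjr := fun r h₁ h₂ => hf.start_le (r := r) h₁ h₂
  have hp : IsPath (i + 1) j k x f := ⟨hlt, hj, hf.finish, fun r h1 h2 => hf.mono r (by omega) h2⟩
  constructor
  · refine ⟨hp, hf.mem, ?_, ?_, ?_, ?_, ?_, ?_⟩
    · intro r c hr1 hr2 hr3 hr4
      have := hjr r (by omega) (by omega)
      rw [hG _ _ (by omega)]
      exact hf.right r c (by omega) hr2 hr3 hr4
    · intro r c hr1 hr2 hr3 hr4 hr5
      have := hjr r (by omega) (by omega)
      rw [hG _ _ (by omega), hG _ _ (by omega)]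
      exact hf.right' r c (by omega) hr2 hr3 hr4 hr5
    · intro r c hr1 hr2 hr3
      rw [hG _ _ (by omega)]
      exact hf.down r c (by omega) hr2 hr3
    · intro r c hr1 hr2 hr3 hr4
      have := hjr (r + 1) (by omega) (by omega)
      rw [hG _ _ (by omega), hG _ _ (by omega)]
      exact hf.down' r c (by omega) hr2 hr3 hr4
    · intro h
      have := hp.start_le (r := k + 1) (by omega) (by omega)
      have := hf.finish
      rw [hG _ _ (by omega)]
      exact hf.stop_right h
    · intro h
      rw [hG _ _ (by omega)]
      exact hf.stop_down h
  · ext r c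
    by_cases ho : OnPath i k f r c
    · obtain ⟨h1, h2, h3, h4⟩ := ho
      have hjc := hjr r h1 (by omega)
      rcases h1.eq_or_lt with rfl | h1
      · obtain rfl : c = j := by omega
        rw [shift_of_eq hf.toIsPath le_rfl hlt hj.symm, shift_of_not fun h => by
          have := h.1
          omega, h₀]
      rcases h4.eq_or_lt with heq | hlt'
      · rcases h2.eq_or_lt with rfl | hlt2
        · obtain rfl : c = x := heq.trans hf.finish
          rw [shift_stop hp, shift_stop hf.toIsPath]
        · rw [shift_of_eq hf.toIsPath h1.le hlt2 heq, shift_of_eq hp h1 hlt2 heq, hG _ _ (by omega)]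
      · rw [shift_of_lt h1.le h2 h3 hlt', shift_of_lt h1 h2 h3 hlt', hG _ _ (by omega)]
    · rw [shift_of_not ho, shift_of_not fun h => ho ⟨by have := h.1; omega, h.2⟩]
      refine hG r c ?_
      rintro ⟨rfl, rfl | rfl⟩
      · exact ho ⟨le_rfl, hle, by omega, by omega⟩
      · exact ho ⟨by omega, by omega, by omega, by have := hf.mono (i + 1) (by omega) hlt; omega⟩

/-- Every special entry has a sliding path. -/
theorem exists_fwdPath (hR : Antitone R) {m : ℕ} (hm : ∀ r, 0 < R r → r < m) (G : ℕ → ℕ → ℤ) (s : ℤ)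
    (hij : j < R i) : ∃ k x f, FwdPath R G s i j k x f := by
  obtain ⟨n, hn⟩ : ∃ n, (m - i) + (R 0 - j) = n := ⟨_, rfl⟩
  induction n using Nat.strong_induction_on generalizing i j with
  | _ n ih =>
    have him := hm i (by omega)
    have hj0 : j < R 0 := hij.trans_le (hR (Nat.zero_le i))
    by_cases hfin : (j + 1 < R i → s + j - i < G i (j + 1)) ∧
        (j < R (i + 1) → s + j - i ≤ G (i + 1) j)
    · refine ⟨i, j, fun _ => j, ⟨⟨le_rfl, rfl, rfl, fun _ _ _ => le_rfl⟩, hij, ?_, ?_, ?_, ?_,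
        hfin.1, hfin.2⟩⟩ <;> intros <;> omega
    by_cases hright : j + 1 < R i ∧ (j < R (i + 1) → G i (j + 1) ≤ G (i + 1) j)
    · obtain ⟨hr1, hr2⟩ := hright
      have := hR (Nat.zero_le i)
      obtain ⟨k, x, f, hf⟩ := ih _ (by omega) hr1 rfl
      have hst := hf.start
      have hle := hf.le
      have hmono := hf.mono i le_rfl hle
      have hu : ∀ r, i < r → Function.update f i j r = f r := fun r hr =>
        Function.update_of_ne (by omega) _ _
      have hG : G i (j + 1) ≤ s + j - i := by
        by_contra! h
        exact hfin ⟨fun _ => h, fun h' => by have := hr2 h'; omega⟩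
      have hu' : ∀ r c, i ≤ r → Function.update f i j r ≤ c → f r ≤ c ∨ (r = i ∧ c = j) := by
        intro r c hr h
        rcases hr.eq_or_lt with rfl | hr
        · rw [Function.update_self] at h
          omega
        · rw [hu r hr] at h
          omega
      refine ⟨k, x, Function.update f i j, ⟨⟨hle, Function.update_self .., ?_, ?_⟩, hf.mem, ?_, ?_,
        ?_, ?_, hf.stop_right, hf.stop_down⟩⟩
      · rw [hu _ (by omega), hf.finish]
      · intro r h1 h2
        rw [hu (r + 1) (by omega)]
        rcases h1.eq_or_lt with rfl | h1
        · rw [Function.update_self]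
          omega
        · rw [hu r h1]
          exact hf.mono r h1.le h2
      · intro r c h1 h2 h3 h4
        rw [hu (r + 1) (by omega)] at h4
        rcases hu' r c h1 h3 with h | ⟨rfl, rfl⟩
        · exact hf.right r c h1 h2 h h4
        · exact hG
      · intro r c h1 h2 h3 h4 h5
        rw [hu (r + 1) (by omega)] at h4
        rcases hu' r c h1 h3 with h | ⟨rfl, rfl⟩
        · exact hf.right' r c h1 h2 h h4 h5
        · exact hr2 h5
      · intro r c h1 h2 h3
        rw [hu (r + 1) (by omega)] at h3
        exact hf.down r c h1 h2 h3
      · intro r c h1 h2 h3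
        rw [hu (r + 1) (by omega)] at h3
        exact hf.down' r c h1 h2 h3
    · have hdown : j < R (i + 1) ∧ (j + 1 < R i → G (i + 1) j < G i (j + 1)) := by
        constructor
        · by_contra h
          refine hfin ⟨fun h' => ?_, fun h' => absurd h' h⟩
          exact absurd ⟨h', fun h' => absurd h' h⟩ hright
        · intro h
          by_contra! h'
          exact hright ⟨h, fun _ => h'⟩
      obtain ⟨hd1, hd2⟩ := hdown
      have hd3 : G (i + 1) j < s + j - i := by
        by_contra! h
        exact hfin ⟨fun h' => by have := hd2 h'; omega, fun _ => h⟩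
      obtain ⟨k, x, f, hf⟩ := ih _ (by omega) hd1 rfl
      have hst := hf.start
      have hle := hf.le
      have hu : ∀ r, i < r → Function.update f i j r = f r := fun r hr =>
        Function.update_of_ne (by omega) _ _
      have hui : Function.update f i j i = j := Function.update_self ..
      refine ⟨k, x, Function.update f i j, ⟨⟨by omega, hui, ?_, ?_⟩, hf.mem, ?_, ?_,
        ?_, ?_, hf.stop_right, hf.stop_down⟩⟩
      · rw [hu _ (by omega), hf.finish]
      · intro r h1 h2
        rw [hu (r + 1) (by omega)]
        rcases h1.eq_or_lt with rfl | h1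
        · omega
        · rw [hu r h1]
          exact hf.mono r h1 h2
      · intro r c h1 h2 h3 h4
        rw [hu (r + 1) (by omega)] at h4
        rcases h1.eq_or_lt with rfl | h1
        · omega
        · rw [hu r h1] at h3
          exact hf.right r c h1 h2 h3 h4
      · intro r c h1 h2 h3 h4
        rw [hu (r + 1) (by omega)] at h4
        rcases h1.eq_or_lt with rfl | h1
        · omega
        · rw [hu r h1] at h3
          exact hf.right' r c h1 h2 h3 h4
      · intro r c h1 h2 h3
        rw [hu (r + 1) (by omega)] at h3
        rcases h1.eq_or_lt with rfl | h1
        · obtain rfl : c = j := by omega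
          exact hd3
        · exact hf.down r c h1 h2 h3
      · intro r c h1 h2 h3
        rw [hu (r + 1) (by omega)] at h3
        rcases h1.eq_or_lt with rfl | h1
        · obtain rfl : c = j := by omega
          exact hd2
        · exact hf.down' r c h1 h2 h3

end Tail

/-- The sliding procedure moves the special entry along a sliding path. -/
theorem slideHC_of_fwdPath {T : Filling μ} {p : Cell μ} {k x : ℕ} {f : ℕ → ℕ}
    (hf : FwdPath μ.rowLen (toGrid T) (T p) p.row p.col k x f) :
    (slideHC T p).1 = ofGrid (shift (toGrid T) (T p) p.row k f) ∧
      (slideHC T p).2.1 = (k, x) := by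
  -- Induction on the number of moves still to be made.
  obtain ⟨n, hn⟩ : ∃ n, (k - p.row) + (x - p.col) = n := ⟨_, rfl⟩
  induction n generalizing T p f with
  | zero =>
    have h1 := hf.le
    have h2 := hf.start_le (r := k + 1) (by omega) le_rfl
    rw [hf.finish] at h2
    obtain rfl : p.row = k := by omega
    obtain rfl : p.col = x := by omega
    rw [slideHC, if_pos ((stopHC_iff T p).2 ⟨hf.stop_right, hf.stop_down⟩)]
    refine ⟨(ofGrid_toGrid T).symm.trans (congrArg ofGrid ?_), rfl⟩
    ext r c
    by_cases hp : OnPath p.row p.row f r c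
    · obtain ⟨h3, h4, h5, h6⟩ := hp
      obtain rfl : p.row = r := by omega
      rw [hf.start] at h5
      rw [hf.finish] at h6
      obtain rfl : p.col = c := by omega
      rw [shift_stop hf.toIsPath, toGrid_cell]
    · rw [shift_of_not hp]
  | succ n ih =>
    have hR := rowLen_antitone μ
    have hle := hf.le
    have h2 := hf.start_le (r := p.row + 1) (by omega) (by omega)
    have h3 := hf.le_stop (r := p.row + 1) (by omega) (by omega)
    have hst := hf.start
    have hER := hf.end_le hR le_rfl hle
    rcases h2.lt_or_eq with hlt | heq
    · have hmem : p.col + 1 < μ.rowLen p.row := by omega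
      obtain ⟨q, hq⟩ : ∃ q : Cell μ, q.1 = (p.row, p.col + 1) := ⟨⟨_, mem_iff.2 hmem⟩, rfl⟩
      have hqr : q.row = p.row := by rw [Cell.row, hq]
      have hqc : q.col = p.col + 1 := by rw [Cell.col, hq]
      have a1 := hf.right p.row p.col le_rfl hle hst.le hlt
      have a2 := hf.right' p.row p.col le_rfl hle hst.le hlt
      have hTq := toGrid_cell T q
      rw [hqr, hqc] at hTq
      push_cast at hTq
      rw [slideHC_right (q := q) (by
        rw [stopHC_iff]
        intro h
        have := h.1 hmem
        omega) ((rightHC_iff T p).2 ⟨hmem, a2⟩) (rightOf_eq_some.2 hq)]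
      obtain ⟨T', hT'⟩ : ∃ T', Function.update (Function.update T p (T q + 1)) q (T p) = T' :=
        ⟨_, rfl⟩
      have hs : T' q = T p := by rw [← hT', Function.update_self]
      have hg : ∀ r c, toGrid T' r c = if r = p.row ∧ c = p.col + 1 then T p + c - r else
          if r = p.row ∧ c = p.col then T q + 1 + c - r else toGrid T r c := by
        intro r c
        rw [← hT', toGrid_update, toGrid_update, hqr, hqc]
      rw [hT']
      obtain ⟨hf', hsh⟩ := hf.tail_right (G' := toGrid T') hlt
        (fun r c h => by rw [hg, if_neg (by omega), if_neg (by omega)])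
        (by rw [hg, if_neg (by omega), if_pos ⟨rfl, rfl⟩, hTq]; ring)
      rw [← hs, ← hqr, ← hqc] at hf'
      obtain ⟨b1, b2⟩ := ih hf' (by omega)
      refine ⟨?_, b2⟩
      rw [b1, ← hsh, hs, hqr, hqc]
    · have hlt : p.row < k := by
        by_contra h
        obtain rfl : p.row = k := by omega
        have := hf.finish
        omega
      have hmem : p.col < μ.rowLen (p.row + 1) := by
        have := hf.end_le hR (r := p.row + 1) (by omega) hlt
        have := hf.mono (p.row + 1) (by omega) hlt
        omega
      obtain ⟨q, hq⟩ : ∃ q : Cell μ, q.1 = (p.row + 1, p.col) := ⟨⟨_, mem_iff.2 hmem⟩, rfl⟩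
      have hqr : q.row = p.row + 1 := by rw [Cell.row, hq]
      have hqc : q.col = p.col := by rw [Cell.col, hq]
      have a1 := hf.down p.row p.col le_rfl hlt heq.symm
      have a2 := hf.down' p.row p.col le_rfl hlt heq.symm
      have hTq := toGrid_cell T q
      rw [hqr, hqc] at hTq
      push_cast at hTq
      rw [slideHC_down (q := q) (by
        rw [stopHC_iff]
        intro h
        have := h.2 hmem
        omega) (by
          rw [rightHC_iff]
          intro h
          have := h.2 hmem
          have := a2 h.1
          omega) (below_eq_some.2 hq)]
      obtain ⟨T', hT'⟩ : ∃ T', Function.update (Function.update T p (T q - 1)) q (T p) = T' :=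
        ⟨_, rfl⟩
      have hs : T' q = T p := by rw [← hT', Function.update_self]
      have hg : ∀ r c, toGrid T' r c = if r = p.row + 1 ∧ c = p.col then T p + c - r else
          if r = p.row ∧ c = p.col then T q - 1 + c - r else toGrid T r c := by
        intro r c
        rw [← hT', toGrid_update, toGrid_update, hqr, hqc]
      rw [hT']
      obtain ⟨hf', hsh⟩ := hf.tail_down (G' := toGrid T') heq.symm hlt
        (fun r c h => by rw [hg, if_neg (by omega), if_neg (by omega)])
        (by rw [hg, if_neg (by omega), if_pos ⟨rfl, rfl⟩, hTq]; ring)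
      rw [← hs, ← hqr, ← hqc] at hf'
      obtain ⟨b1, b2⟩ := ih hf' (by omega)
      refine ⟨?_, b2⟩
      rw [b1, ← hsh, hs, hqr]

end HookContent

/-! ### One loop is a bijection between consecutive stages. -/

namespace HookContent

variable {μ : YoungDiagram}

/-- Column `j` of a filling, as a function of the row, zero outside of the diagram. -/
def column (H : Filling μ) (j r : ℕ) : ℤ := if h : (r, j) ∈ μ then H ⟨(r, j), h⟩ else 0

theorem column_cell (H : Filling μ) (p : Cell μ) : column H p.col p.row = H p := by
  rw [column, dif_pos p.2]

theorem column_of_eq (H : Filling μ) {p : Cell μ} {r j : ℕ} (h : p.1 = (r, j)) :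
    column H j r = H p := by
  rw [← column_cell H p, Cell.col, Cell.row, h]

theorem column_eq_zero (H : Filling μ) {r j : ℕ} (h : ¬ j < μ.rowLen r) : column H j r = 0 :=
  dif_neg fun hm => h (mem_iff.1 hm)

/-- The pairs which occur in Algorithm HC when the columns to the right of column `j`, and column
`j` from row `i` on, are processed. -/
structure Stage (μ : YoungDiagram) (b i j : ℕ) (S : Filling μ × Filling μ) : Prop where
  sorted : SortedFrom μ.rowLen i j (toGrid S.1)
  bounded : Bounded μ.rowLen b j (toGrid S.1)
  hook : ∀ p : Cell μ, Processed μ.rowLen i j p.row p.col → -arm p ≤ S.2 p ∧ S.2 p ≤ leg p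
  zero : ∀ p : Cell μ, ¬ Processed μ.rowLen i j p.row p.col → S.2 p = 0
  good : Good μ.rowLen (toGrid S.1) i j (column S.2 j)

theorem mem_colLen {j : ℕ} (r : ℕ) : j < μ.rowLen r ↔ r < μ.colLen j :=
  mem_iff.symm.trans YoungDiagram.mem_iff_lt_colLen

theorem hookRange_column {H : Filling μ} {i j : ℕ}
    (h : ∀ p : Cell μ, Processed μ.rowLen i j p.row p.col → -arm p ≤ H p ∧ H p ≤ leg p) :
    HookRange μ.rowLen (μ.colLen j) i j (column H j) := by
  intro r hi hj
  have := h ⟨(r, j), mem_iff.2 hj⟩ ⟨hj, Or.inr ⟨rfl, hi⟩⟩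
  rwa [← column_of_eq H (p := ⟨(r, j), mem_iff.2 hj⟩) rfl] at this

theorem hook_of_hookRange {H H' : Filling μ} {i i' j : ℕ}
    (h : HookRange μ.rowLen (μ.colLen j) i j (column H j))
    (hH : ∀ p : Cell μ, p.col ≠ j → H p = H' p)
    (h' : ∀ p : Cell μ, Processed μ.rowLen i' j p.row p.col → -arm p ≤ H' p ∧ H' p ≤ leg p)
    (p : Cell μ) (hp : Processed μ.rowLen i j p.row p.col) : -arm p ≤ H p ∧ H p ≤ leg p := by
  by_cases hj : p.col = j
  · subst hj
    have := h p.row (by rcases hp.2 with h | h <;> omega) hp.1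
    rwa [column_cell] at this
  · rw [hH p hj]
    exact h' p ⟨hp.1, by rcases hp.2 with h | h <;> omega⟩

theorem toGrid_ofGrid_of_zero {G : ℕ → ℕ → ℤ} (h : ∀ r c, ¬ c < μ.rowLen r → G r c = 0) :
    toGrid (ofGrid G : Filling μ) = G := by
  ext r c
  by_cases hc : c < μ.rowLen r
  · exact toGrid_ofGrid G hc
  · rw [toGrid_eq_zero _ hc, h r c hc]

theorem OnPath.lt_rowLen {i j k x r c : ℕ} {f : ℕ → ℕ} (hf : IsPath i j k x f)
    (hx : x < μ.rowLen k) (h : OnPath i k f r c) : c < μ.rowLen r :=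
  h.2.2.2.trans_lt ((hf.le_stop (by have := h.1; omega) (by have := h.2.1; omega)).trans_lt
    (hx.trans_le (rowLen_antitone μ h.2.1)))

theorem toGrid_ofGrid_shift {i j k x : ℕ} {f : ℕ → ℕ} (hf : IsPath i j k x f)
    (hx : x < μ.rowLen k) (T : Filling μ) (s : ℤ) :
    toGrid (ofGrid (shift (toGrid T) s i k f) : Filling μ) = shift (toGrid T) s i k f :=
  toGrid_ofGrid_of_zero fun r c hc => by
    rw [shift_of_not fun hp => hc (hp.lt_rowLen hf hx), toGrid_eq_zero _ hc]

theorem toGrid_ofGrid_unshift {i j k x : ℕ} {f : ℕ → ℕ} (hf : IsPath i j k x f)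
    (hx : x < μ.rowLen k) (T : Filling μ) (s : ℤ) :
    toGrid (ofGrid (unshift (toGrid T) s i k f) : Filling μ) = unshift (toGrid T) s i k f :=
  toGrid_ofGrid_of_zero fun r c hc => by
    rw [unshift_of_not fun hp => hc (hp.lt_rowLen hf hx), toGrid_eq_zero _ hc]

theorem updateHook_of_col_ne {H : Filling μ} {p p' q : Cell μ} (h : q.col ≠ p.col) :
    updateHook H p p' q = H q := by
  simp [updateHook, h]

theorem column_updateHook (H : Filling μ) {p p' : Cell μ}
    (hc : p.col ≤ p'.col) :
    column (updateHook H p p') p.col = hookShift (column H p.col) p.row p.col p'.row p'.col := by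
  ext r
  have hp' : p.col < μ.rowLen p'.row := hc.trans_lt (mem_iff.1 p'.2)
  by_cases hm : p.col < μ.rowLen r
  · obtain ⟨q, hq⟩ : ∃ q : Cell μ, q.1 = (r, p.col) := ⟨⟨_, mem_iff.2 hm⟩, rfl⟩
    have hqr : q.row = r := by rw [Cell.row, hq]
    have hqc : q.col = p.col := by rw [Cell.col, hq]
    rw [column_of_eq _ hq]
    simp only [updateHook, hookShift, hqr, hqc, true_and]
    split_ifs with h1 h2
    · have hm2 : p.col < μ.rowLen (r + 1) := hp'.trans_le (rowLen_antitone μ h1.2)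
      rw [below_eq_some (q := ⟨_, mem_iff.2 hm2⟩) |>.2 (by rw [hqr, hqc])]
      simp [column, mem_iff.2 hm2]
    · rfl
    · rw [column_of_eq _ hq]
  · have : p'.row < r := by
      by_contra h
      exact hm (hp'.trans_le (rowLen_antitone μ (not_lt.1 h)))
    rw [column_eq_zero _ hm, hookShift, if_neg (by omega), if_neg (by omega), column_eq_zero _ hm]

section Loop

variable {b : ℕ} {S : Filling μ × Filling μ} {p : Cell μ} {k x : ℕ} {f : ℕ → ℕ}

theorem toGrid_loopHC (hf : FwdPath μ.rowLen (toGrid S.1) (S.1 p) p.row p.col k x f) :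
    toGrid (loopHC S p).1 = shift (toGrid S.1) (S.1 p) p.row k f := by
  rw [loopHC, (slideHC_of_fwdPath hf).1, toGrid_ofGrid_shift hf.toIsPath hf.mem]

theorem column_loopHC (hf : FwdPath μ.rowLen (toGrid S.1) (S.1 p) p.row p.col k x f) :
    column (loopHC S p).2 p.col = hookShift (column S.2 p.col) p.row p.col k x := by
  have h := (slideHC_of_fwdPath hf).2
  have hx := hf.start_le (r := k + 1) (by have := hf.le; omega) le_rfl
  rw [hf.finish] at hx
  have h1 : (slideHC S.1 p).2.row = k := by rw [Cell.row, h]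
  have h2 : (slideHC S.1 p).2.col = x := by rw [Cell.col, h]
  simp only [loopHC]
  rw [column_updateHook _ (by rwa [h2]), h1, h2]

theorem loopHC_of_col_ne {q : Cell μ} (h : q.col ≠ p.col) : (loopHC S p).2 q = S.2 q :=
  updateHook_of_col_ne h

theorem exists_fwdPath_filling (T : Filling μ) (p : Cell μ) :
    ∃ k x f, FwdPath μ.rowLen (toGrid T) (T p) p.row p.col k x f :=
  exists_fwdPath (rowLen_antitone μ) (m := μ.colLen 0) (fun r hr => (mem_colLen r).1 hr) _ _
    (mem_iff.1 p.2)

/-- The champion is returned together with the new stage, since injectivity needs to recognise the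
stopping cell from the output. -/
theorem Stage.loopHC (hS : Stage μ b (p.row + 1) p.col S)
    (hf : FwdPath μ.rowLen (toGrid S.1) (S.1 p) p.row p.col k x f) :
    Stage μ b p.row p.col (loopHC S p) ∧
      Champion μ.rowLen (toGrid (HookContent.loopHC S p).1)
        (column (HookContent.loopHC S p).2 p.col) p.row p.col k x f := by
  have hR := rowLen_antitone μ
  have hh := hookRange_column hS.hook
  have hc := hf.champion hR hS.sorted hh hS.good
  rw [← column_loopHC hf, ← toGrid_loopHC hf] at hc
  refine ⟨⟨?_, ?_, ?_, ?_, hc.1⟩, hc.2⟩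
  · rw [toGrid_loopHC hf]
    exact hf.sorted_shift hR hS.sorted
  · rw [toGrid_loopHC hf]
    exact hf.bounded_shift hR hS.sorted hS.bounded (toGrid_cell _ _)
  · refine hook_of_hookRange ?_ (fun q hq => loopHC_of_col_ne hq) hS.hook
    rw [column_loopHC hf]
    exact hf.hookRange_hookShift hR mem_colLen hh
  · intro q hq
    have hq' : ¬ Processed μ.rowLen (p.row + 1) p.col q.row q.col := fun h =>
      hq ⟨h.1, by have := h.2; omega⟩
    by_cases h : q.col = p.col
    · have hlt : q.row < p.row := by
        by_contra hlt
        exact hq ⟨mem_iff.1 q.2, Or.inr ⟨h, not_lt.1 hlt⟩⟩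
      have := hf.le
      rw [← column_cell (HookContent.loopHC S p).2 q, h, column_loopHC hf,
        hookShift, if_neg (by omega), if_neg (by omega), ← h, column_cell, hS.zero q hq']
    · rw [loopHC_of_col_ne h, hS.zero q hq']

/-- From a common output, uniqueness of the champion gives the same stopping cell, and uniqueness of
reverse paths the same path. The value found at the stopping cell gives `s`, and `unshift` and
`hookUnshift` restore the input. -/
theorem injOn_loopHC (p : Cell μ) :
    InjOn (fun S => loopHC S p) {S | Stage μ b (p.row + 1) p.col S} := by
  rintro S hS S' hS' heq
  obtain ⟨k, x, f, hf⟩ := exists_fwdPath_filling S.1 p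
  obtain ⟨k', x', f', hf'⟩ := exists_fwdPath_filling S'.1 p
  have hc := (hS.loopHC hf).2
  have hc' := (hS'.loopHC hf').2
  have hg := toGrid_loopHC hf
  have hg' := toGrid_loopHC hf'
  have hh := column_loopHC hf
  have hh' := column_loopHC hf'
  dsimp only at heq
  rw [← heq] at hc' hg' hh'
  have hjx := hf.start_le (r := k + 1) (by have := hf.le; omega) le_rfl
  have hjx' := hf'.start_le (r := k' + 1) (by have := hf'.le; omega) le_rfl
  rw [hf.finish] at hjx
  rw [hf'.finish] at hjx'
  obtain ⟨rfl, rfl⟩ := hc.unique hc' (hjx.trans_lt hf.mem) (hjx'.trans_lt hf'.mem)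
  have hff : ∀ r, p.row ≤ r → r ≤ k + 1 → f r = f' r := fun r h1 h2 =>
    hc.path.unique hc'.path h1 h2
  have hs : S.1 p = S'.1 p := by
    have h1 := shift_stop (G := toGrid S.1) (s := S.1 p) hf.toIsPath
    have h2 := shift_stop (G := toGrid S'.1) (s := S'.1 p) hf'.toIsPath
    rw [← hg] at h1
    rw [← hg'] at h2
    omega
  refine Prod.ext (toGrid_injective ?_) ?_
  · rw [← unshift_shift (G := toGrid S.1) hf.toIsPath (toGrid_cell _ _), ← hg,
      ← unshift_shift (G := toGrid S'.1) hf'.toIsPath (toGrid_cell _ _), ← hg', hs,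
      unshift_congr hff]
  · have h0 : ∀ {S : Filling μ × Filling μ}, Stage μ b (p.row + 1) p.col S →
        column S.2 p.col p.row = 0 := fun hS => by
      rw [column_cell]
      exact hS.zero p fun h => by have := h.2; omega
    ext q
    by_cases h : q.col = p.col
    · rw [← column_cell S.2 q, ← column_cell S'.2 q, h,
        ← hookUnshift_hookShift (j := p.col) (x := x) hf.le (h0 hS), ← hh,
        ← hookUnshift_hookShift (j := p.col) (x := x) hf.le (h0 hS'), ← hh']
    · rw [← loopHC_of_col_ne (S := S) h, heq, loopHC_of_col_ne h]

/-- The preimage is obtained by moving the entry in the champion's cell back along its reverse path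
and shifting the hook column back. -/
theorem surjOn_loopHC (p : Cell μ) :
    SurjOn (fun S => loopHC S p) {S | Stage μ b (p.row + 1) p.col S}
      {S | Stage μ b p.row p.col S} := by
  rintro S (hS : Stage μ b p.row p.col S)
  have hR := rowLen_antitone μ
  have hh := hookRange_column hS.hook
  obtain ⟨k, x, f, hk, hc⟩ := exists_champion mem_colLen hh hS.good
    ((mem_colLen _).1 (mem_iff.1 p.2))
  have hp := hc.path
  have hik := hp.le
  have hjx := hp.start_le (r := k + 1) (by omega) le_rfl
  rw [hp.finish] at hjx
  have hx : x < μ.rowLen k := by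
    have h1 := hh k hik ((mem_colLen _).2 hk)
    have h2 := hc.value
    omega
  obtain ⟨s, hs⟩ : ∃ s, toGrid S.1 k x = s + x - k := ⟨toGrid S.1 k x - x + k, by ring⟩
  obtain ⟨T, hT⟩ : ∃ T : Filling μ, toGrid T = unshift (toGrid S.1) s p.row k f :=
    ⟨_, toGrid_ofGrid_unshift hp.toIsPath hx S.1 s⟩
  obtain ⟨H, hH⟩ : ∃ H : Filling μ, H = fun q =>
    if q.col = p.col then hookUnshift (column S.2 p.col) p.row k q.row else S.2 q := ⟨_, rfl⟩
  have hHcol : column H p.col = hookUnshift (column S.2 p.col) p.row k := by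
    ext r
    by_cases hr : p.col < μ.rowLen r
    · rw [column, dif_pos (mem_iff.2 hr), hH]
      simp
    · have : k < r := by
        by_contra h
        exact hr ((hjx.trans_lt hx).trans_le (hR (not_lt.1 h)))
      rw [column_eq_zero _ hr, hookUnshift, if_neg (by omega), if_neg (by omega),
        column_eq_zero _ hr]
  have hHne : ∀ q : Cell μ, q.col ≠ p.col → H q = S.2 q := fun q hq => by rw [hH]; simp [hq]
  have hTp : T p = s := by
    have h1 := toGrid_cell T p
    rw [hT, unshift_start hp.toIsPath] at h1
    omega
  have hf : FwdPath μ.rowLen (toGrid T) (T p) p.row p.col k x f := by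
    rw [hT, hTp]
    exact hp.fwdPath_unshift hR hx hS.sorted hs
  refine ⟨(T, H), ⟨?_, ?_, ?_, ?_, ?_⟩, ?_⟩
  · rw [hT]
    exact hp.sorted_unshift hR hx hS.sorted
  · rw [hT]
    exact hp.bounded_unshift hR hx hS.sorted hS.bounded hs
  · refine hook_of_hookRange ?_ hHne hS.hook
    rw [hHcol]
    exact hc.hookRange_hookUnshift hR hx hh
  · intro q hq
    change H q = 0
    by_cases h : q.col = p.col
    · have hle : q.row ≤ p.row := by
        by_contra hlt
        exact hq ⟨mem_iff.1 q.2, Or.inr ⟨h, not_le.1 hlt⟩⟩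
      rw [← column_cell H, h, hHcol, hookUnshift]
      split_ifs with h1 h2
      · rfl
      · omega
      · rw [← h, column_cell]
        exact hS.zero q fun h => by have := h.2; omega
    · rw [hHne q h]
      exact hS.zero q fun h' => hq ⟨h'.1, by have := h'.2; omega⟩
  · rw [hT, hHcol]
    exact hc.good_hookUnshift hR hx hS.sorted hh hS.good
  · refine Prod.ext (toGrid_injective ?_) ?_
    · rw [toGrid_loopHC (S := (T, H)) hf, hT]
      simp only [hTp, shift_unshift hp.toIsPath hs]
    · ext q
      by_cases h : q.col = p.col
      · simp only
        rw [← column_cell (loopHC (T, H) p).2 q, ← column_cell S.2 q, h,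
          column_loopHC (S := (T, H)) hf, hHcol,
          hookShift_hookUnshift hik hc.value]
      · exact (loopHC_of_col_ne h).trans (hHne q h)

theorem bijOn_loopHC (b : ℕ) (p : Cell μ) :
    BijOn (fun S => loopHC S p) {S | Stage μ b (p.row + 1) p.col S}
      {S | Stage μ b p.row p.col S} := by
  refine ⟨fun S hS => ?_, injOn_loopHC p, surjOn_loopHC p⟩
  obtain ⟨k, x, f, hf⟩ := exists_fwdPath_filling S.1 p
  exact (Stage.loopHC hS hf).1

end Loop

end HookContent

/-! ### Composition of the loops. -/

namespace HookContent

/-- The right fold treats the last block first, so the index of `S` decreases from `n` to `0`. It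
serves for the cells within a column and again for the columns. -/
theorem bijOn_foldr_flatMap {α β : Type*} (F : α → β → β) {n : ℕ} (g : Fin n → List α)
    (S : ℕ → Set β) (h : ∀ j : Fin n, BijOn (fun s => (g j).foldr F s) (S (j + 1)) (S j)) :
    BijOn (fun s => ((List.finRange n).flatMap g).foldr F s) (S n) (S 0) := by
  induction n generalizing S with
  | zero => exact bijOn_id (S 0)
  | succ n ih =>
    simp only [List.finRange_succ, List.flatMap_cons, List.flatMap_map, List.foldr_append]
    exact (h 0).comp (ih (fun j => g j.succ) (fun j => S (j + 1)) fun j => h j.succ)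

variable {μ : YoungDiagram} {b j : ℕ} {S : Filling μ × Filling μ}

theorem bijOn_column (b j : ℕ) :
    BijOn (fun S => ((List.finRange (μ.colLen j)).map fun i : Fin (μ.colLen j) =>
      (⟨((i : ℕ), j), YoungDiagram.mem_iff_lt_colLen.2 i.isLt⟩ : Cell μ)).foldr
        (fun p S => loopHC S p) S) {S | Stage μ b (μ.colLen j) j S} {S | Stage μ b 0 j S} := by
  simp only [List.map_eq_flatMap]
  exact bijOn_foldr_flatMap _ _ (fun i => {S | Stage μ b i j S}) fun i => bijOn_loopHC b _

theorem processed_colLen_iff {r c : ℕ} :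
    Processed μ.rowLen (μ.colLen j) j r c ↔ Processed μ.rowLen 0 (j + 1) r c := by
  unfold Processed
  refine and_congr_right fun hc => ?_
  have : c = j → r < μ.colLen j := by
    rintro rfl
    exact (mem_colLen r).1 hc
  omega

/-- No row lies above row `0`, so no reverse path can escape upwards; the chosen barrier has no left
steps below row `0`. -/
theorem good_zero (R : ℕ → ℕ) (G : ℕ → ℕ → ℤ) (j : ℕ) (h : ℕ → ℤ) : Good R G 0 j h := by
  intro r y _ _ hy _
  obtain ⟨g, hg, -⟩ := exists_backPath (G := G) (i := 0) (j := j) (k := r) (r := r) (y := y)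
    (u := fun r => if r = 0 then j else y) rfl
    (fun r _ _ => by split_ifs <;> omega)
    (fun r c _ _ h1 h2 => by simp at h1 h2; omega)
    (Nat.zero_le _) le_rfl hy (by simp)
  exact ⟨g, hg⟩

/-- Changing the reference column from `j + 1` to `j` trades the lower bound `c - j` for one weaker
by one. Going back from right to left weakens `Bounded.low`; in the other direction only column `j +
1` needs a new bound, which is `lower` there. `Good` is vacuous below the last row of the column. -/
theorem stage_colLen_iff : Stage μ b (μ.colLen j) j S ↔ Stage μ b 0 (j + 1) S := by
  constructor
  · rintro ⟨h1, h2, h3, h4, h5⟩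
    simp only [processed_colLen_iff] at h3 h4
    refine ⟨⟨?_, ?_⟩, ⟨?_, ?_, h2.upper⟩, h3, h4, good_zero _ _ _ _⟩
    · simpa only [processed_colLen_iff] using h1.row
    · simpa only [processed_colLen_iff] using h1.col
    · intro r c hc hcj
      rcases hcj.lt_or_eq with h | rfl
      · exact h2.one_le r c hc (by omega)
      · have := h2.lower r (j + 1) hc (by omega)
        push_cast at this
        omega
    · intro r c hc hcj
      have := h2.lower r c hc (by omega)
      push_cast
      omega
  · rintro ⟨h1, h2, h3, h4, h5⟩
    simp only [← processed_colLen_iff] at h3 h4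
    refine ⟨⟨?_, ?_⟩, ⟨?_, ?_, h2.upper⟩, h3, h4, ?_⟩
    · simpa only [processed_colLen_iff] using h1.row
    · simpa only [processed_colLen_iff] using h1.col
    · intro r c hc hcj
      exact h2.one_le r c hc (by omega)
    · intro r c hc hcj
      rcases hcj.lt_or_eq with h | rfl
      · have := h2.low h1 (Nat.zero_le r) h hc
        push_cast at this
        omega
      · have := h2.one_le r j hc (by omega)
        omega
    · intro r y hr hjr
      have := (mem_colLen r).1 hjr
      omega

theorem stage_rowLen_iff : Stage μ b 0 (μ.rowLen 0) S ↔ S.1 ∈ contentTabloids μ b ∧ S.2 = 0 := by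
  have hp : ∀ r c, ¬ Processed μ.rowLen 0 (μ.rowLen 0) r c := fun r c h => by
    have := h.1.trans_le (rowLen_antitone μ (Nat.zero_le r))
    have := h.2
    omega
  constructor
  · intro h
    refine ⟨fun p => ?_, funext fun p => h.zero p (hp _ _)⟩
    have h0 := mem_iff.1 p.2
    have h1 := h.bounded.one_le p.row p.col h0
      (h0.le.trans (rowLen_antitone μ (Nat.zero_le _)))
    have h2 := h.bounded.upper p.row p.col h0
    rw [toGrid_cell] at h1 h2
    rw [content]
    omega
  · rintro ⟨h1, h2⟩
    have h3 : ∀ r c, c < μ.rowLen r → 1 ≤ toGrid S.1 r c ∧ toGrid S.1 r c ≤ b + c - r := by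
      intro r c hc
      have := h1 ⟨(r, c), mem_iff.2 hc⟩
      rw [content] at this
      rw [toGrid, dif_pos (mem_iff.2 hc)]
      simp only [Cell.row, Cell.col] at this
      omega
    refine ⟨⟨fun r c h => (hp r c h).elim, fun r c h => (hp r c h).elim⟩,
      ⟨fun r c hc _ => (h3 r c hc).1, fun r c hc h => ?_, fun r c hc => (h3 r c hc).2⟩,
      fun p h => (hp _ _ h).elim, fun p _ => by rw [h2]; rfl, good_zero _ _ _ _⟩
    have := hc.trans_le (rowLen_antitone μ (Nat.zero_le r))
    omega

theorem le_of_adjacent {A : ℕ → ℤ} {n : ℕ} (h : ∀ c, c + 1 < n → A c ≤ A (c + 1)) {c c' : ℕ}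
    (hcc : c < c') (hc' : c' < n) : A c ≤ A c' := by
  induction c', hcc using Nat.le_induction with
  | base => exact h c hc'
  | succ m hm ih => exact (ih (by omega)).trans (h m hc')

/-- The columns start with at least `1` and increase strictly; this is the lower bound `c + 1` for
the grid. -/
theorem row_lt_of_mem_tableaux {T : Filling μ} (hT : T ∈ tableaux μ b) (p : Cell μ) :
    (p.row : ℤ) + 1 ≤ T p := by
  obtain ⟨⟨r, c⟩, hp⟩ := p
  induction r with
  | zero => simpa using (hT.2.2 ⟨(0, c), hp⟩).1
  | succ n ih =>
    have hm : (n, c) ∈ μ := μ.up_left_mem (Nat.le_succ n) le_rfl hp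
    have h1 := ih hm
    have h2 := hT.2.1 ⟨(n, c), hm⟩ ⟨(n + 1, c), hp⟩ rfl (Nat.lt_succ_self n)
    simp only [Cell.row] at h1 ⊢
    push_cast
    omega

theorem stage_zero_iff :
    Stage μ b 0 0 S ↔ S.1 ∈ tableaux μ b ∧ S.2 ∈ hookTabloids μ := by
  have hp : ∀ r c, c < μ.rowLen r → Processed μ.rowLen 0 0 r c := fun r c h => ⟨h, by omega⟩
  have hcell : ∀ p : Cell μ, p.col < μ.rowLen p.row := fun p => mem_iff.1 p.2
  constructor
  · intro h
    refine ⟨⟨?_, ?_, ?_⟩, fun p => h.hook p (hp _ _ (hcell p))⟩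
    · intro p q hrow hlt
      have h1 := le_of_adjacent (A := fun c => toGrid S.1 p.row c - c) (n := μ.rowLen p.row)
        (fun c hc => by
          have := h.sorted.row p.row c (hp _ _ (by omega)) hc
          push_cast
          omega) hlt (hrow ▸ hcell q)
      rw [toGrid_cell, hrow, toGrid_cell] at h1
      omega
    · intro p q hcol hlt
      have h1 := le_of_adjacent (A := fun r => toGrid S.1 r p.col) (n := μ.colLen p.col)
        (fun r hr => by
          have hr' := (mem_colLen _).2 hr
          exact h.sorted.col r p.col (hp _ _ ((mem_colLen _).2 (by omega))) hr') hlt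
        ((mem_colLen _).1 (hcol ▸ hcell q))
      rw [toGrid_cell, hcol, toGrid_cell] at h1
      omega
    · intro p
      have h1 := h.bounded.low h.sorted (Nat.zero_le p.row) (Nat.zero_le p.col) (hcell p)
      have h2 := h.bounded.upper p.row p.col (hcell p)
      rw [toGrid_cell] at h1 h2
      push_cast at h1
      omega
  · rintro ⟨hT, hH⟩
    have hlow : ∀ r c, c < μ.rowLen r → (c : ℤ) + 1 ≤ toGrid S.1 r c ∧
        toGrid S.1 r c ≤ b + c - r := by
      intro r c hc
      have h1 := row_lt_of_mem_tableaux hT ⟨(r, c), mem_iff.2 hc⟩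
      have h2 := hT.2.2 ⟨(r, c), mem_iff.2 hc⟩
      rw [toGrid, dif_pos (mem_iff.2 hc)]
      simp only [Cell.row] at h1
      omega
    refine ⟨⟨?_, ?_⟩, ⟨?_, ?_, fun r c hc => (hlow r c hc).2⟩, fun p _ => hH p,
      fun p h => (h (hp _ _ (hcell p))).elim, good_zero _ _ _ _⟩
    · intro r c h hc
      have := hT.1 ⟨(r, c), mem_iff.2 h.1⟩ ⟨(r, c + 1), mem_iff.2 hc⟩ rfl (Nat.lt_succ_self c)
      rw [toGrid, dif_pos (mem_iff.2 h.1), toGrid, dif_pos (mem_iff.2 hc)]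
      push_cast
      omega
    · intro r c h hc
      have := hT.2.1 ⟨(r, c), mem_iff.2 h.1⟩ ⟨(r + 1, c), mem_iff.2 hc⟩ rfl (Nat.lt_succ_self r)
      rw [toGrid, dif_pos (mem_iff.2 h.1), toGrid, dif_pos (mem_iff.2 hc)]
      push_cast
      omega
    · intro r c hc _
      have := hlow r c hc
      omega
    · intro r c hc _
      have := hlow r c hc
      push_cast
      omega

/-- Algorithm HC is a bijection. -/
theorem bijOn_algorithmHC (μ : YoungDiagram) (b : ℕ) :
    BijOn algorithmHC (contentTabloids μ b) (tableaux μ b ×ˢ hookTabloids μ) := by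
  have h1 : BijOn (fun S => (cellList μ).foldr (fun p S => loopHC S p) S)
      {S | Stage μ b 0 (μ.rowLen 0) S} {S | Stage μ b 0 0 S} := by
    refine bijOn_foldr_flatMap _ _ (fun j => {S | Stage μ b 0 j S}) fun j => ?_
    have := bijOn_column (μ := μ) b j
    simpa only [stage_colLen_iff] using this
  have h2 : BijOn (fun C : Filling μ => (C, (0 : Filling μ))) (contentTabloids μ b)
      {S | Stage μ b 0 (μ.rowLen 0) S} := by
    refine ⟨fun C hC => stage_rowLen_iff.2 ⟨hC, rfl⟩, fun C _ C' _ h => congrArg Prod.fst h, ?_⟩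
    rintro ⟨C, H⟩ h
    obtain ⟨hC, hH⟩ := stage_rowLen_iff.1 h
    exact ⟨C, hC, Prod.ext rfl hH.symm⟩
  have h3 : {S | Stage μ b 0 0 S} = tableaux μ b ×ˢ hookTabloids μ :=
    Set.ext fun S => stage_zero_iff
  have h4 : (algorithmHC : Filling μ → _) =
      (fun S => (cellList μ).foldr (fun p S => loopHC S p) S) ∘ fun C => (C, 0) := by
    ext1 C
    exact List.foldl_reverse
  rw [h4, ← h3]
  exact h1.comp h2

end HookContent

/-! ### Algorithm PP as the complement of Algorithm HC. -/

namespace HookContent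

variable {μ : YoungDiagram}

theorem complementFilling_complementFilling (b : ℕ) (F : Filling μ) :
    complementFilling b (complementFilling b F) = F := by
  ext p
  simp only [complementFilling]
  ring

theorem complementFilling_injective (b : ℕ) :
    Function.Injective (complementFilling b : Filling μ → Filling μ) :=
  Function.Involutive.injective (complementFilling_complementFilling b)

theorem bijOn_complementFilling {b : ℕ} {s t : Set (Filling μ)}
    (h : ∀ F, F ∈ s ↔ complementFilling b F ∈ t) : BijOn (complementFilling b) s t :=
  ⟨fun _ hF => (h _).1 hF, (complementFilling_injective b).injOn, fun G hG =>
    ⟨complementFilling b G, (h _).2 (by rwa [complementFilling_complementFilling]),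
      complementFilling_complementFilling b G⟩⟩

theorem mem_rect {a c r j : ℕ} : (r, j) ∈ rect a c ↔ r < a ∧ j < c := by
  rw [← YoungDiagram.mem_cells]
  simp [rect]

theorem add_le_of_mem_tableaux {b : ℕ} {T : Filling μ} (hT : T ∈ tableaux μ b) {p q : Cell μ}
    (hcol : p.col = q.col) (hrow : p.row ≤ q.row) : T p + q.row - p.row ≤ T q := by
  have h0 : (0 : Filling μ) ∈ hookTabloids μ := fun t => by
    have h1 : t.col < μ.rowLen t.row := mem_iff.1 t.2
    have h2 : t.row < μ.colLen t.col := (mem_colLen _).1 h1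
    simp only [arm, leg, Pi.zero_apply]
    omega
  -- Pairing `T` with the zero hook tabloid makes it a final stage, so the grid inequality
  -- `SortedFrom.le_of_le` can be used.
  have hs := (stage_zero_iff (S := (T, 0))).2 ⟨hT, h0⟩
  have := hs.sorted.le_of_le (rowLen_antitone μ) (Nat.zero_le _) (Nat.zero_le _) hrow hcol.le
    (mem_iff.1 q.2)
  dsimp only at this
  rw [toGrid_cell, toGrid_cell] at this
  omega

theorem bijOn_planePartitions (a b c : ℕ) :
    BijOn (complementFilling b) (planePartitions (rect a c) b) (tableaux (rect a c) (a + b)) := by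
  refine bijOn_complementFilling fun F => ?_
  constructor
  · rintro ⟨h1, h2, h3⟩
    refine ⟨fun p q hrow hlt => ?_, fun p q hcol hlt => ?_, fun p => ?_⟩
    · have := h1 p q hrow hlt
      simp only [complementFilling]
      omega
    · have := h2 p q hcol hlt
      simp only [complementFilling]
      omega
    · have := h3 p
      have : p.row < a := (mem_rect.1 p.2).1
      simp only [complementFilling]
      push_cast
      omega
  · intro h
    have hcol : ∀ p q : Cell (rect a c), p.col = q.col → p.row ≤ q.row → F q ≤ F p := by
      intro p q hcol hlt
      have := add_le_of_mem_tableaux h hcol hlt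
      simp only [complementFilling] at this
      omega
    refine ⟨fun p q hrow hlt => ?_, fun p q h1 hlt => hcol p q h1 hlt.le, fun p => ⟨?_, ?_⟩⟩
    · have := h.1 p q hrow hlt
      simp only [complementFilling] at this
      omega
    · have hp : p.row < a ∧ p.col < c := mem_rect.1 p.2
      -- Nonnegativity comes from the bottom cell of the column, where the upper bound `a + b` for
      -- the tableau reads `0 ≤ F q`.
      obtain ⟨q, hq⟩ : ∃ q : Cell (rect a c), q.1 = (a - 1, p.col) :=
        ⟨⟨_, mem_rect.2 ⟨by omega, hp.2⟩⟩, rfl⟩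
      have hqr : q.row = a - 1 := by rw [Cell.row, hq]
      refine le_trans ?_ (hcol p q (by simp only [Cell.col, hq]) (by omega))
      have := (h.2.2 q).2
      simp only [complementFilling, hqr] at this
      push_cast at this
      omega
    · have := row_lt_of_mem_tableaux h p
      simp only [complementFilling] at this
      omega

theorem bijOn_inputsPP (a b c : ℕ) :
    BijOn (complementFilling b) (inputsPP a b c) (contentTabloids (rect a c) (a + b)) := by
  refine bijOn_complementFilling fun F => forall_congr' fun p => ?_
  simp only [lowerPP, upperPP, content, complementFilling]
  omega

section Slide

theorem slidePP_right {F : Filling μ} {p q : Cell μ}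
    (h₁ : ¬ (botEntry F (rightOf p) ≤ (F p : WithBot ℤ) ∧
      botEntry F (below p) ≤ (F p : WithBot ℤ)))
    (h₂ : botEntry F (below p) + 1 ≤ botEntry F (rightOf p)) (hq : rightOf p = some q) :
    slidePP F p =
      ((slidePP (Function.update (Function.update F p (F q - 1)) q (F p)) q).1,
        (slidePP (Function.update (Function.update F p (F q - 1)) q (F p)) q).2 + 1) := by
  rw [slidePP, if_neg h₁, if_pos h₂]
  split
  · rename_i q' h
    obtain rfl : q' = q := Option.some.inj (h.symm.trans hq)
    rfl
  · rename_i h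
    rw [hq] at h
    cases h

theorem slidePP_down {F : Filling μ} {p q : Cell μ}
    (h₁ : ¬ (botEntry F (rightOf p) ≤ (F p : WithBot ℤ) ∧
      botEntry F (below p) ≤ (F p : WithBot ℤ)))
    (h₂ : ¬ botEntry F (below p) + 1 ≤ botEntry F (rightOf p)) (hq : below p = some q) :
    slidePP F p =
      ((slidePP (Function.update (Function.update F p (F q)) q (F p + 1)) q).1,
        (slidePP (Function.update (Function.update F p (F q)) q (F p + 1)) q).2 + 1) := by
  rw [slidePP, if_neg h₁, if_neg h₂]
  split
  · rename_i q' h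
    obtain rfl : q' = q := Option.some.inj (h.symm.trans hq)
    rfl
  · rename_i h
    rw [hq] at h
    cases h

theorem row_of_rightOf {p q : Cell μ} (h : rightOf p = some q) : q.row = p.row := by
  rw [Cell.row, rightOf_eq_some.1 h]

theorem row_of_below {p q : Cell μ} (h : below p = some q) : q.row = p.row + 1 := by
  rw [Cell.row, below_eq_some.1 h]

theorem stopPP_iff (b : ℕ) (F : Filling μ) (p : Cell μ) :
    (botEntry F (rightOf p) ≤ (F p : WithBot ℤ) ∧ botEntry F (below p) ≤ (F p : WithBot ℤ)) ↔
      ((complementFilling b F p : WithTop ℤ) ≤ topEntry (complementFilling b F) (rightOf p) ∧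
        (complementFilling b F p : WithTop ℤ) < topEntry (complementFilling b F) (below p)) := by
  refine and_congr ?_ ?_
  · rcases h : rightOf p with _ | q
    · simp [botEntry, topEntry]
    · have := row_of_rightOf h
      simp only [botEntry, topEntry, WithBot.coe_le_coe, WithTop.coe_le_coe, complementFilling]
      omega
  · rcases h : below p with _ | q
    · simp [botEntry, topEntry]
    · have := row_of_below h
      simp only [botEntry, topEntry, WithBot.coe_le_coe, WithTop.coe_lt_coe, complementFilling]
      omega

/-- With both neighbours missing the equivalence fails: `⊥ + 1 ≤ ⊥` is true, whereas `⊤ + 1 < ⊤` is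
false. -/
theorem rightPP_iff (b : ℕ) (F : Filling μ) (p : Cell μ)
    (h : ¬ (rightOf p = none ∧ below p = none)) :
    botEntry F (below p) + 1 ≤ botEntry F (rightOf p) ↔
      topEntry (complementFilling b F) (rightOf p) + 1 <
        topEntry (complementFilling b F) (below p) := by
  rcases h1 : rightOf p with _ | q <;> rcases h2 : below p with _ | q'
  · exact absurd ⟨h1, h2⟩ h
  · simp only [botEntry, topEntry]
    rw [← WithBot.coe_one, ← WithBot.coe_add]
    simp
  · simp only [botEntry, topEntry]
    rw [← WithTop.coe_one, ← WithTop.coe_add]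
    simp
  · have := row_of_rightOf h1
    have := row_of_below h2
    simp only [botEntry, topEntry, complementFilling]
    rw [← WithBot.coe_one, ← WithBot.coe_add, WithBot.coe_le_coe, ← WithTop.coe_one,
      ← WithTop.coe_add, WithTop.coe_lt_coe]
    omega

theorem exists_neighbour {F : Filling μ} {p : Cell μ}
    (h₁ : ¬ (botEntry F (rightOf p) ≤ (F p : WithBot ℤ) ∧
      botEntry F (below p) ≤ (F p : WithBot ℤ))) :
    ¬ (rightOf p = none ∧ below p = none) := by
  rintro ⟨h, h'⟩
  simp [h, h', botEntry] at h₁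

theorem rightOf_ne_none {F : Filling μ} {p : Cell μ} (h : ¬ (rightOf p = none ∧ below p = none))
    (h₂ : botEntry F (below p) + 1 ≤ botEntry F (rightOf p)) : ∃ q, rightOf p = some q := by
  rcases h1 : rightOf p with _ | q
  · rcases h' : below p with _ | q'
    · exact absurd ⟨h1, h'⟩ h
    · rw [h1, h'] at h₂
      simp only [botEntry] at h₂
      rw [← WithBot.coe_one, ← WithBot.coe_add] at h₂
      simp at h₂
  · exact ⟨q, rfl⟩

theorem below_ne_none {F : Filling μ} {p : Cell μ}
    (h₂ : ¬ botEntry F (below p) + 1 ≤ botEntry F (rightOf p)) : ∃ q, below p = some q := by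
  rcases h' : below p with _ | q
  · simp [h', botEntry] at h₂
  · exact ⟨q, rfl⟩

/-- The complement reverses order and depends on the row. A move within a row therefore only changes
signs, while a move down absorbs one unit, which is why PP raises `s` and not the entry that moves
up. -/
theorem complementFilling_slidePP (b : ℕ) (F : Filling μ) (p : Cell μ) :
    complementFilling b (slidePP F p).1 = (slideHC (complementFilling b F) p).1 := by
  obtain ⟨n, hn⟩ : ∃ n, room p = n := ⟨_, rfl⟩
  induction n using Nat.strong_induction_on generalizing F p with
  | _ n ih =>
    by_cases h1 : botEntry F (rightOf p) ≤ (F p : WithBot ℤ) ∧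
        botEntry F (below p) ≤ (F p : WithBot ℤ)
    · rw [slidePP, if_pos h1, slideHC, if_pos ((stopPP_iff b F p).1 h1)]
    · have hne := exists_neighbour h1
      by_cases h2 : botEntry F (below p) + 1 ≤ botEntry F (rightOf p)
      · obtain ⟨q, hq⟩ := rightOf_ne_none hne h2
        rw [slidePP_right h1 h2 hq, slideHC_right (mt (stopPP_iff b F p).2 h1)
          ((rightPP_iff b F p hne).1 h2) hq]
        dsimp only
        rw [ih _ (hn ▸ room_rightOf hq) _ _ rfl]
        congr 2
        have := row_of_rightOf hq
        ext t
        simp only [complementFilling, Function.update_apply]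
        split_ifs with h3 h4
        · subst h3; omega
        · subst h4; omega
        · rfl
      · obtain ⟨q, hq⟩ := below_ne_none h2
        rw [slidePP_down h1 h2 hq, slideHC_down (mt (stopPP_iff b F p).2 h1)
          (mt (rightPP_iff b F p hne).2 h2) hq]
        dsimp only
        rw [ih _ (hn ▸ room_below hq) _ _ rfl]
        congr 2
        have := row_of_below hq
        ext t
        simp only [complementFilling, Function.update_apply]
        split_ifs with h3 h4
        · subst h3; omega
        · subst h4; omega
        · rfl

theorem slidePP_moves (F : Filling μ) (p : Cell μ) : (slidePP F p).2 + 2 ≤ room p := by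
  obtain ⟨n, hn⟩ : ∃ n, room p = n := ⟨_, rfl⟩
  induction n using Nat.strong_induction_on generalizing F p with
  | _ n ih =>
    by_cases h1 : botEntry F (rightOf p) ≤ (F p : WithBot ℤ) ∧
        botEntry F (below p) ≤ (F p : WithBot ℤ)
    · rw [slidePP, if_pos h1]
      have h2 : p.row < μ.colLen 0 := YoungDiagram.mem_iff_lt_colLen.1
        (μ.up_left_mem le_rfl (Nat.zero_le p.col) p.2)
      have h3 : p.col < μ.rowLen 0 := YoungDiagram.mem_iff_lt_rowLen.1
        (μ.up_left_mem (Nat.zero_le p.row) le_rfl p.2)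
      simp only [room]
      omega
    · by_cases h2 : botEntry F (below p) + 1 ≤ botEntry F (rightOf p)
      · obtain ⟨q, hq⟩ := rightOf_ne_none (exists_neighbour h1) h2
        have hr := room_rightOf hq
        have := ih _ (hn ▸ hr) (Function.update (Function.update F p (F q - 1)) q (F p)) _ rfl
        rw [slidePP_right h1 h2 hq]
        dsimp only
        omega
      · obtain ⟨q, hq⟩ := below_ne_none h2
        have hr := room_below hq
        have := ih _ (hn ▸ hr) (Function.update (Function.update F p (F q)) q (F p + 1)) _ rfl
        rw [slidePP_down h1 h2 hq]
        dsimp only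
        omega

theorem complementFilling_foldl (b : ℕ) (l : List (Cell μ)) (F H : Filling μ) (n : ℕ) :
    complementFilling b (l.foldl loopPP (F, n)).1 =
      (l.foldl loopHC (complementFilling b F, H)).1 := by
  induction l generalizing F H n with
  | nil => rfl
  | cons p l ih =>
    rw [List.foldl_cons, List.foldl_cons, loopPP, loopHC, ih, complementFilling_slidePP]

theorem complementFilling_algorithmPP {a c : ℕ} (b : ℕ) (F : Filling (rect a c)) :
    complementFilling b (algorithmPP F) = (algorithmHC (complementFilling b F)).1 :=
  complementFilling_foldl b _ F 0 0

theorem foldl_loopPP_moves (l : List (Cell μ)) (F : Filling μ) (n : ℕ) :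
    (l.foldl loopPP (F, n)).2 ≤ n + (l.map fun p => room p - 2).sum := by
  induction l generalizing F n with
  | nil => simp
  | cons p l ih =>
    rw [List.foldl_cons, loopPP, List.map_cons, List.sum_cons]
    have := slidePP_moves F p
    exact (ih _ _).trans (by dsimp only; omega)

end Slide

/-! ### The worst-case number of moves. -/

section Moves

theorem sum_map_cellList (g : Cell μ → ℕ) :
    ((cellList μ).map g).sum = ∑ j : Fin (μ.rowLen 0), ∑ i : Fin (μ.colLen j),
      g ⟨((i : ℕ), (j : ℕ)), YoungDiagram.mem_iff_lt_colLen.2 i.isLt⟩ := by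
  simp only [Fin.sum_univ_def, cellList, List.flatMap, List.map_flatten, List.sum_flatten,
    List.map_map, Function.comp_def]

theorem rowLen_rect {a c r : ℕ} (h : r < a) : (rect a c).rowLen r = c :=
  eq_of_forall_lt_iff fun j => by rw [← mem_iff, mem_rect]; simp [h]

theorem colLen_rect {a c j : ℕ} (h : j < c) : (rect a c).colLen j = a :=
  eq_of_forall_lt_iff fun r => by rw [← YoungDiagram.mem_iff_lt_colLen, mem_rect]; simp [h]

/-- The left side bounds the moves for one column with `n` columns to its right; it equals `a.choose
2 + a * n`, and the right side exceeds it by `n.choose 2`. -/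
theorem sum_range_le_choose (a n : ℕ) :
    ∑ i ∈ Finset.range a, (a - 1 - i + n) ≤ (a + n).choose 2 := by
  induction a with
  | zero => simp
  | succ a ih =>
    rw [Finset.sum_range_succ', show a + 1 + n = a + n + 1 by ring, Nat.choose_succ_succ' (a + n) 1,
      Nat.choose_one_right]
    have : ∑ i ∈ Finset.range a, (a + 1 - 1 - (i + 1) + n) =
        ∑ i ∈ Finset.range a, (a - 1 - i + n) :=
      Finset.sum_congr rfl fun i _ => by omega
    rw [this]
    simp only [Nat.add_sub_cancel, Nat.reduceAdd]
    omega

theorem movesPP_le {a c : ℕ} (F : Filling (rect a c)) :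
    movesPP F ≤ ∑ i ∈ Finset.Ico a (a + c), i.choose 2 := by
  refine (foldl_loopPP_moves _ F 0).trans ?_
  rw [zero_add, List.map_reverse, List.sum_reverse, sum_map_cellList]
  -- For `a = 0` the diagram is empty and its row length is `0` instead of `c`.
  rcases Nat.eq_zero_or_pos a with rfl | ha
  · have h0 : (rect 0 c).rowLen 0 = 0 := by
      by_contra h
      have := mem_rect.1 (mem_iff.2 (Nat.pos_of_ne_zero h))
      omega
    have : IsEmpty (Fin ((rect 0 c).rowLen 0)) := by rw [h0]; infer_instance
    simp
  · have hrow : (rect a c).rowLen 0 = c := rowLen_rect ha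
    calc
      _ ≤ ∑ j : Fin ((rect a c).rowLen 0), (a + (c - 1 - (j : ℕ))).choose 2 := by
        refine Finset.sum_le_sum fun j _ => ?_
        have hj : (j : ℕ) < c := j.isLt.trans_eq hrow
        have hcol := colLen_rect (a := a) hj
        refine le_trans (le_of_eq ?_) (sum_range_le_choose a (c - 1 - j))
        simp only [room]
        rw [Fin.sum_univ_eq_sum_range (fun i => ((rect a c).colLen 0 - i) +
          ((rect a c).rowLen 0 - j) - 2) ((rect a c).colLen j), hcol,
          colLen_rect (by omega : 0 < c)]
        refine Finset.sum_congr rfl fun i hi => ?_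
        have := Finset.mem_range.1 hi
        omega
      _ = _ := by
        rw [Fin.sum_univ_eq_sum_range (fun j => (a + (c - 1 - j)).choose 2), hrow,
          Finset.sum_range_reflect (fun j => (a + j).choose 2), Finset.sum_Ico_eq_sum_range,
          Nat.add_sub_cancel_left]

theorem sum_choose_two_le (a c : ℕ) :
    ∑ i ∈ Finset.Ico a (a + c), i.choose 2 ≤ c * (3 * a ^ 2 + 3 * a * c + c ^ 2) := by
  refine (Finset.sum_le_card_nsmul _ _ ((a + c) ^ 2) fun i hi => ?_).trans ?_
  · have := (Finset.mem_Ico.1 hi).2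
    exact (Nat.choose_le_pow i 2).trans (Nat.pow_le_pow_left this.le 2)
  · rw [Nat.card_Ico, Nat.add_sub_cancel_left, smul_eq_mul]
    exact Nat.mul_le_mul_left c (by nlinarith)

end Moves

end HookContent

/-! ### Uniform distributions. -/

namespace HookContent

section Uniform

/-- All fibres having the same size `N`, the factor `N` cancels in the quotient of cardinalities.
Bijections are the case `N = 1`, projections of products the case of the size of the other factor.
-/
theorem map_uniformOn_of_fiber {α β : Type*} [MeasurableSpace α] [MeasurableSingletonClass α]
    [Countable α] [MeasurableSpace β] [MeasurableSingletonClass β] [Countable β]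
    {f : α → β} {s : Finset α} {t : Finset β} {N : ℕ} [DecidableEq β] (hN : N ≠ 0)
    (hf : ∀ x ∈ s, f x ∈ t) (hfib : ∀ y ∈ t, (s.filter fun x => f x = y).card = N) :
    (uniformOn (s : Set α)).map f = uniformOn (t : Set β) := by
  classical
  refine Measure.ext_iff_singleton.2 fun y => ?_
  have hcard : s.card = t.card * N := by
    rw [Finset.card_eq_sum_card_fiberwise hf, Finset.sum_congr rfl hfib, Finset.sum_const,
      smul_eq_mul]
  rw [Measure.map_apply (measurable_of_countable f) (measurableSet_singleton y)]
  have h1 : uniformOn (s : Set α) (f ⁻¹' {y}) =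
      uniformOn (s : Set α) (s.filter fun x => f x = y : Finset α) := by
    rw [← uniformOn_inter_self s.finite_toSet]
    congr 1
    ext x
    simp
  rw [h1, ← Finset.coe_singleton, uniformOn_apply_finset, uniformOn_apply_finset,
    Finset.inter_eq_right.2 (Finset.filter_subset _ _), hcard]
  by_cases hy : y ∈ t
  · rw [hfib y hy, Finset.inter_singleton_of_mem hy, Finset.card_singleton, Nat.cast_mul]
    have hN' : (N : ENNReal) ≠ 0 := by exact_mod_cast hN
    rw [Nat.cast_one, mul_comm, ENNReal.div_eq_inv_mul, ENNReal.mul_inv (Or.inl hN')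
      (Or.inl (ENNReal.natCast_ne_top N)), mul_comm, ← mul_assoc,
      ENNReal.mul_inv_cancel hN' (ENNReal.natCast_ne_top N), one_mul, one_div]
  · rw [Finset.inter_singleton_of_notMem hy, Finset.filter_eq_empty_iff.2]
    · simp
    · rintro x hx rfl
      exact hy (hf x hx)

variable {α β : Type*} [MeasurableSpace α] [MeasurableSingletonClass α]
    [Countable α] [MeasurableSpace β] [MeasurableSingletonClass β] [Countable β]

theorem map_uniformOn_of_bijOn {f : α → β} {s : Set α} {t : Set β} (hs : s.Finite)
    (h : BijOn f s t) : (uniformOn s).map f = uniformOn t := by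
  classical
  have ht : t.Finite := h.image_eq ▸ hs.image f
  lift s to Finset α using hs
  lift t to Finset β using ht
  refine map_uniformOn_of_fiber one_ne_zero h.mapsTo fun y hy => ?_
  obtain ⟨x, hx, rfl⟩ := h.surjOn hy
  rw [Finset.card_eq_one]
  refine ⟨x, Finset.ext fun z => ?_⟩
  simp only [Finset.mem_filter, Finset.mem_singleton]
  exact ⟨fun hz => h.injOn hz.1 hx hz.2, by rintro rfl; exact ⟨hx, rfl⟩⟩

theorem map_fst_uniformOn {s : Set α} {t : Set β} (hs : s.Finite) (ht : t.Finite)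
    (hne : t.Nonempty) : (uniformOn (s ×ˢ t)).map Prod.fst = uniformOn s := by
  classical
  lift s to Finset α using hs
  lift t to Finset β using ht
  rw [← Finset.coe_product]
  refine map_uniformOn_of_fiber (N := t.card) (Finset.card_ne_zero.2 (by simpa using hne))
    (fun x hx => (Finset.mem_product.1 hx).1) fun y hy => ?_
  rw [Finset.filter_product_left (fun x => x = y), Finset.card_product, Finset.filter_eq' s y,
    if_pos hy, Finset.card_singleton, one_mul]

theorem map_snd_uniformOn {s : Set α} {t : Set β} (hs : s.Finite) (ht : t.Finite)
    (hne : s.Nonempty) : (uniformOn (s ×ˢ t)).map Prod.snd = uniformOn t := by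
  classical
  lift s to Finset α using hs
  lift t to Finset β using ht
  rw [← Finset.coe_product]
  refine map_uniformOn_of_fiber (N := s.card) (Finset.card_ne_zero.2 (by simpa using hne))
    (fun x hx => (Finset.mem_product.1 hx).2) fun y hy => ?_
  rw [Finset.filter_product_right (fun x => x = y), Finset.card_product, Finset.filter_eq' t y,
    if_pos hy, Finset.card_singleton, mul_one]

theorem uniformOn_pi_of_finite {ι : Type*} [Fintype ι] (s : ι → Set α)
    (hs : ∀ i, (s i).Finite) : uniformOn (Set.univ.pi s) = Measure.pi fun i => uniformOn (s i) := by
  classical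
  lift s to ι → Finset α using hs
  refine Measure.ext_iff_singleton.2 fun x => ?_
  rw [Measure.pi_singleton, ← Fintype.coe_piFinset]
  have : ({x} : Set (ι → α)) = (Fintype.piFinset fun i => {x i} : Finset _) := by
    ext y
    simp [funext_iff]
  rw [this, uniformOn_apply_finset, ← Fintype.piFinset_inter]
  simp only [← Finset.coe_singleton, uniformOn_apply_finset, Fintype.card_piFinset, Nat.cast_prod]
  exact (ENNReal.prod_div_distrib_of_ne_top (by simp)).symm

end Uniform

variable {μ : YoungDiagram} {Ω : Type*} [MeasurableSpace Ω] {P : Measure Ω} [IsProbabilityMeasure P]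

instance : Fintype (Cell μ) := inferInstanceAs (Fintype {p // p ∈ μ.cells})

theorem IsIndepUniform.map_eq {X : Cell μ → Ω → ℤ} {lo hi : Cell μ → ℤ}
    (h : IsIndepUniform P X lo hi) :
    P.map (fun ω p => X p ω) = uniformOn (Set.univ.pi fun p => Set.Icc (lo p) (hi p)) := by
  rw [(iIndepFun_iff_map_fun_eq_pi_map fun p => (h.measurable p).aemeasurable).1 h.indep,
    uniformOn_pi_of_finite _ fun p => Set.finite_Icc _ _]
  simp only [h.uniform]

/-- The image of independent uniform entries under a map of fillings. -/
theorem IsIndepUniform.map_comp {β : Type*} [MeasurableSpace β] {X : Cell μ → Ω → ℤ}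
    {lo hi : Cell μ → ℤ} (h : IsIndepUniform P X lo hi) (g : Filling μ → β) :
    P.map (fun ω => g fun p => X p ω) =
      (uniformOn (Set.univ.pi fun p => Set.Icc (lo p) (hi p))).map g := by
  rw [← h.map_eq, Measure.map_map (measurable_of_countable g)
    (measurable_pi_iff.2 h.measurable)]
  rfl

theorem pi_Icc_eq {lo hi : Cell μ → ℤ} :
    (Set.univ.pi fun p => Set.Icc (lo p) (hi p)) =
      {F : Filling μ | ∀ p, lo p ≤ F p ∧ F p ≤ hi p} := by
  ext F
  simp only [Set.mem_pi, Set.mem_univ, true_imp_iff, Set.mem_Icc, Set.mem_ofPred_eq]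

theorem finite_contentTabloids (μ : YoungDiagram) (b : ℕ) : (contentTabloids μ b).Finite := by
  rw [contentTabloids, ← pi_Icc_eq]
  exact Set.Finite.pi fun p => Set.finite_Icc (1 - content p) (b : ℤ)

theorem nonempty_contentTabloids {b : ℕ} (hb : μ.colLen 0 ≤ b) :
    (contentTabloids μ b).Nonempty := by
  refine ⟨fun _ => b, fun p => ⟨?_, le_rfl⟩⟩
  have h : p.row < μ.colLen 0 := YoungDiagram.mem_iff_lt_colLen.1
    (μ.up_left_mem le_rfl (Nat.zero_le p.col) p.2)
  simp only [content]
  omega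

/-- The bound on `b` enters only to make the content tabloids, and hence both factors of the
product, nonempty; without this the marginals need not be uniform. -/
theorem map_algorithmHC_uniformOn {b : ℕ} (hb : μ.colLen 0 ≤ b) :
    ((uniformOn (contentTabloids μ b)).map fun C => (algorithmHC C).2) =
        uniformOn (hookTabloids μ) ∧
      ((uniformOn (contentTabloids μ b)).map fun C => (algorithmHC C).1) =
        uniformOn (tableaux μ b) := by
  have hbij := bijOn_algorithmHC μ b
  have hfin := finite_contentTabloids μ b
  have hmap := map_uniformOn_of_bijOn hfin hbij
  have hfin' : (tableaux μ b ×ˢ hookTabloids μ).Finite := hbij.image_eq ▸ hfin.image _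
  obtain ⟨h1, h2⟩ := Set.prod_nonempty_iff.1
    (hbij.image_eq ▸ (nonempty_contentTabloids hb).image algorithmHC)
  have hf1 := hfin'.of_prod_left h2
  have hf2 := hfin'.of_prod_right h1
  rw [← map_fst_uniformOn hf1 hf2 h2, ← map_snd_uniformOn hf1 hf2 h1, ← hmap,
    Measure.map_map measurable_snd (measurable_of_countable _),
    Measure.map_map measurable_fst (measurable_of_countable _)]
  exact ⟨rfl, rfl⟩

theorem finite_inputsPP (a b c : ℕ) : (inputsPP a b c).Finite :=
  Set.Finite.of_finite_image (by
    rw [(bijOn_inputsPP a b c).image_eq]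
    exact finite_contentTabloids _ _) (bijOn_inputsPP a b c).injOn

/-- Algorithm PP is the composite of the complement, the tableau part of Algorithm HC, and the
complement again; each of the three preserves uniformity. -/
theorem map_algorithmPP_uniformOn (a b c : ℕ) :
    (uniformOn (inputsPP a b c)).map algorithmPP = uniformOn (planePartitions (rect a c) b) := by
  have hcol : (rect a c).colLen 0 ≤ a + b := by
    by_contra! h
    have := (mem_rect.1 (YoungDiagram.mem_iff_lt_colLen.2 h)).1
    omega
  have h1 := map_uniformOn_of_bijOn (finite_inputsPP a b c) (bijOn_inputsPP a b c)
  have hinv := Set.InvOn.bijOn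
    (f := complementFilling b) (f' := complementFilling b) (s := tableaux (rect a c) (a + b))
    (t := planePartitions (rect a c) b)
    ⟨fun F _ => complementFilling_complementFilling b F,
      fun F _ => complementFilling_complementFilling b F⟩
    (fun T hT => by
      obtain ⟨F, hF, rfl⟩ := (bijOn_planePartitions a b c).surjOn hT
      rwa [complementFilling_complementFilling]) (bijOn_planePartitions a b c).mapsTo
  have hfin : (tableaux (rect a c) (a + b)).Finite := by
    have hbij := bijOn_algorithmHC (rect a c) (a + b)
    have hfin' := hbij.image_eq ▸ (finite_contentTabloids (rect a c) (a + b)).image algorithmHC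
    obtain ⟨-, h2⟩ := Set.prod_nonempty_iff.1
      (hbij.image_eq ▸ (nonempty_contentTabloids hcol).image algorithmHC)
    exact hfin'.of_prod_left h2
  rw [← map_uniformOn_of_bijOn hfin hinv, ← (map_algorithmHC_uniformOn hcol).2, ← h1,
    Measure.map_map (measurable_of_countable _) (measurable_of_countable _),
    Measure.map_map (measurable_of_countable _) (measurable_of_countable _)]
  congr 1
  ext1 F
  simp only [Function.comp_apply]
  rw [← complementFilling_algorithmPP, complementFilling_complementFilling]

end HookContent

theorem mainTheorem2 {Ω : Type*} [MeasurableSpace Ω] (P : Measure Ω) [IsProbabilityMeasure P] :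
    -- semistandard tableaux
    (∀ (μ : YoungDiagram) (b : ℕ), μ.colLen 0 ≤ b →
      BijOn algorithmHC (contentTabloids μ b) (tableaux μ b ×ˢ hookTabloids μ) ∧
      ∀ C : Cell μ → Ω → ℤ,
        IsIndepUniform P C (fun p => 1 - content p) (fun _ => (b : ℤ)) →
          P.map (fun ω => (algorithmHC fun p => C p ω).2) = uniformOn (hookTabloids μ) ∧
          P.map (fun ω => (algorithmHC fun p => C p ω).1) = uniformOn (tableaux μ b)) ∧
    -- plane partitions
    (∀ a b c : ℕ,
      BijOn (complementFilling b) (planePartitions (rect a c) b) (tableaux (rect a c) (a + b)) ∧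
      BijOn (complementFilling b) (inputsPP a b c) (contentTabloids (rect a c) (a + b)) ∧
      (∀ F ∈ inputsPP a b c,
        complementFilling b (algorithmPP F) = (algorithmHC (complementFilling b F)).1) ∧
      ∀ F : Cell (rect a c) → Ω → ℤ,
        IsIndepUniform P F (lowerPP a) (upperPP b) →
          P.map (fun ω => algorithmPP fun p => F p ω) = uniformOn (planePartitions (rect a c) b)) ∧
    -- worst-case number of moves of Algorithm PP
    (∃ K : ℕ, ∀ a b c : ℕ,
      (∀ F ∈ inputsPP a b c, movesPP F ≤ K * ∑ i ∈ Finset.Ico a (a + c), i.choose 2) ∧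
      ∑ i ∈ Finset.Ico a (a + c), i.choose 2 ≤ K * (c * (3 * a ^ 2 + 3 * a * c + c ^ 2))) := by
  refine ⟨fun μ b hb => ⟨bijOn_algorithmHC μ b, fun C hC => ?_⟩,
    fun a b c => ⟨bijOn_planePartitions a b c, bijOn_inputsPP a b c,
      fun F _ => complementFilling_algorithmPP b F, fun F hF => ?_⟩,
    1, fun a b c => ⟨fun F _ => ?_, ?_⟩⟩
  · rw [hC.map_comp fun C => (algorithmHC C).2, hC.map_comp fun C => (algorithmHC C).1, pi_Icc_eq]
    exact map_algorithmHC_uniformOn hb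
  · rw [hF.map_comp algorithmPP, pi_Icc_eq]
    exact map_algorithmPP_uniformOn a b c
  · rw [one_mul]
    exact movesPP_le F
  · rw [one_mul]
    exact sum_choose_two_le a c
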